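/- Let $H_1(x,y)=-x(\log x-\log y)+(x-y)(\log(y-x)-\log y)$ for $0\le x\le y$ (with $0\log 0=0$) and $H(x)=H_1(x,1)$. For $d\ge 3$ and $\lambda>0$ let \begin{align*} f(\alpha,\beta,\gamma,\delta,\epsilon)={}&2(\alpha+\beta)\log\lambda+H(\alpha)+H_1(\gamma,\alpha)+H_1(\alpha-\gamma,1-\alpha)+H(\beta)+H_1(\delta,\beta)+H_1(\beta-\delta,1-\beta)\\ &+d\big[H_1(\gamma,1-2\beta+\delta)-H(\gamma)+H_1(\epsilon,1-2\beta+\delta-\gamma)+H_1(\alpha-\gamma-\epsilon,\beta-\delta)\\ &\qquad-H_1(\alpha-\gamma,1-\gamma)+H_1(\alpha-\gamma,1-\beta-\gamma-\epsilon)-H_1(\alpha-\gamma,1-\alpha)\big] \end{align*} be the second-moment exponent of the hardcore model with fugacity $\lambda$ on the random $d$-regular bipartite graph, and let $g_{\alpha,\beta}(\gamma,\delta,\epsilon)=f(\alpha,\beta,\gamma,\delta,\epsilon)$. The admissible region for $(\alpha,\beta)$ is the set of all $(\gamma,\delta,\epsilon)$ with $$\alpha-\gamma-\epsilon\ge 0,\quad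 \beta-\delta\ge 0,\quad 1-2\beta+\delta-\gamma-\epsilon\ge 0$$ at which $f$ is defined, that is, with moreover $\gamma,\delta,\epsilon\ge 0$, $\beta-\delta-(\alpha-\gamma-\epsilon)\ge 0$ and $1-\alpha-\beta-\epsilon\ge 0$. Let $p^+$ (respectively $p^-$) be the occupation density of the root of the infinite $d$-regular tree under the weak limit, as $\ell\to\infty$, of the hardcore model with fugacity $\lambda$ conditioned on level $2\ell$ (respectively level $2\ell+1$) being completely occupied; that is, the limit of the conditional probabilities that the root is occupied. Let $\lambda=1$ and $d=6$. Then the limits $p^+$ and $p^-$ exist, and there is a constant $\chi>0$ such that for all real $\alpha,\beta$ with $|p^+-\beta|<\chi$ and $|p^--\alpha|<\chi$, the function $g_{\alpha,\beta}$ attains its maximum over the admissible region at the point $(\gamma^*,\delta^*,\epsilon^*)=(\alpha^2,\beta^2,\alpha(1-\alpha-\beta))$ and at no other point of the region. -/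

import Mathlib

open Filter Topology

/-! ### The hardcore model on a finite graph -/

open Classical in
/-- The total weight `∑ lam ^ |S|` of the independent sets `S` of `G` that lie in the event `A`
(a configuration in `{0,1}^V` is identified with its set of occupied vertices). -/
noncomputable def hardcoreWeight {V : Type*} [Fintype V] (G : SimpleGraph V) (lam : ℝ)
    (A : Set (Finset V)) : ℝ :=
  ∑ S ∈ (Finset.univ : Finset (Finset V)).filter (fun S : Finset V => G.IsIndepSet (S : Set V) ∧ S ∈ A),
    lam ^ S.card

/-- The probability of the event `A` under the hardcore model on `G` with fugacity `lam`;
the denominator is the partition function of `G`. -/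
noncomputable def hardcoreProb {V : Type*} [Fintype V] (G : SimpleGraph V) (lam : ℝ)
    (A : Set (Finset V)) : ℝ :=
  hardcoreWeight G lam A / hardcoreWeight G lam Set.univ

/-- The conditional probability of `A` given `B` under the hardcore model on `G`. -/
noncomputable def hardcoreCondProb {V : Type*} [Fintype V] (G : SimpleGraph V) (lam : ℝ)
    (A B : Set (Finset V)) : ℝ :=
  hardcoreProb G lam (A ∩ B) / hardcoreProb G lam B

/-! ### The infinite regular tree -/

/-- Vertices of the `d`-regular tree: words over `d` letters without two equal consecutive letters
(the word of a vertex lists the labels of the edges on the path from the root to it). -/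
abbrev TreeVertex (d : ℕ) : Type := {w : List (Fin d) // w.IsChain (· ≠ ·)}

/-- The root of the `d`-regular tree: the empty word. -/
def treeRoot (d : ℕ) : TreeVertex d := ⟨[], by simp⟩

/-- The level of a vertex: its distance from the root. -/
def treeLevel {d : ℕ} (v : TreeVertex d) : ℕ := v.1.length

/-- The `d`-regular tree: the children of a vertex are the words with one more letter at the
end. -/
def regularTree (d : ℕ) : SimpleGraph (TreeVertex d) :=
  SimpleGraph.fromRel fun u v => ∃ a : Fin d, v.1 = u.1 ++ [a]

/-- The vertices of the `d`-regular tree at level at most `n`. -/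
def treeBall (d n : ℕ) : Set (TreeVertex d) := {v | treeLevel v ≤ n}

theorem finite_treeBall (d n : ℕ) : (treeBall d n).Finite :=
  (List.finite_length_le (Fin d) n).preimage Subtype.val_injective.injOn

noncomputable instance instFintypeTreeBall (d n : ℕ) : Fintype (treeBall d n) :=
  (finite_treeBall d n).fintype

/-- The probability that the root of the `d`-regular tree is occupied in the hardcore model with
fugacity `lam`, conditionally on level `n` of the tree being completely occupied. By the Markov
property only the finite tree formed by the levels up to `n` matters. -/
noncomputable def rootDensity (d : ℕ) (lam : ℝ) (n : ℕ) : ℝ :=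
  hardcoreCondProb ((regularTree d).induce (treeBall d n)) lam
    {S | ∃ v ∈ S, (v : TreeVertex d) = treeRoot d}
    {S | ∀ v : treeBall d n, treeLevel (v : TreeVertex d) = n → v ∈ S}

/-- `pPlus` and `pMinus` are the occupation densities of the two semi-translation invariant
extremal measures of the hardcore model on the `d`-regular tree: the weak limits obtained by
conditioning on level `2ℓ`, respectively `2ℓ + 1`, to be completely occupied. -/
def AreExtremalDensities (d : ℕ) (lam pPlus pMinus : ℝ) : Prop :=
  Tendsto (fun l : ℕ => rootDensity d lam (2 * l)) atTop (𝓝 pPlus) ∧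
    Tendsto (fun l : ℕ => rootDensity d lam (2 * l + 1)) atTop (𝓝 pMinus)

/-! ### The second moment exponent -/

/-- `H₁(x, y) = -x (log x - log y) + (x - y) (log (y - x) - log y)` for `0 ≤ x ≤ y`,
with `0 log 0 = 0`. -/
noncomputable def entropyH₁ (x y : ℝ) : ℝ :=
  -x * (Real.log x - Real.log y) + (x - y) * (Real.log (y - x) - Real.log y)

/-- `H(x) = H₁(x, 1)`. -/
noncomputable def entropyH (x : ℝ) : ℝ := entropyH₁ x 1

/-- The exponent `f(α, β, γ, δ, ε)` of the second moment of the partition function restricted to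
configurations of density `α` on the plus side and `β` on the minus side. -/
noncomputable def secondMomentExponent (d : ℕ) (lam α β γ δ ε : ℝ) : ℝ :=
  2 * (α + β) * Real.log lam
    + entropyH α + entropyH₁ γ α + entropyH₁ (α - γ) (1 - α)
    + entropyH β + entropyH₁ δ β + entropyH₁ (β - δ) (1 - β)
    + d * (entropyH₁ γ (1 - 2 * β + δ) - entropyH γ
        + entropyH₁ ε (1 - 2 * β + δ - γ)
        + entropyH₁ (α - γ - ε) (β - δ) - entropyH₁ (α - γ) (1 - γ)
        + entropyH₁ (α - γ) (1 - β - γ - ε) - entropyH₁ (α - γ) (1 - α))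

/-- The admissible triples `(γ, δ, ε)`. The first three constraints, the nonnegativity of
`γ, δ, ε` and the last two together say, for `α, β ≥ 0` with `α + β ≤ 1`, exactly that every term `H₁(x, y)` of the
exponent has `0 ≤ x ≤ y`, that is, that all the logarithms are taken of nonnegative numbers. -/
def admissibleRegion (α β : ℝ) : Set (ℝ × ℝ × ℝ) :=
  {x | let γ := x.1; let δ := x.2.1; let ε := x.2.2
    (0 ≤ α - γ - ε ∧ 0 ≤ β - δ ∧ 0 ≤ 1 - 2 * β + δ - γ - ε) ∧
    (0 ≤ γ ∧ 0 ≤ δ ∧ 0 ≤ ε) ∧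
    0 ≤ β - δ - (α - γ - ε) ∧ 0 ≤ 1 - α - β - ε}

/-- The function `g` attains its maximum over `s` at `x₀ ∈ s` and at no other point of `s`. -/
def AttainsUniqueMaxAt {X : Type*} (g : X → ℝ) (s : Set X) (x₀ : X) : Prop :=
  x₀ ∈ s ∧ ∀ x ∈ s, x ≠ x₀ → g x < g x₀

/-! Read every density as a density of edges. One configuration splits the edges into three types:
occupied on the left (α), occupied on the right (β), free (1 - α - β); its exponent is Φ =
`blockExponent`. For a pair of configurations, sort the edges by their type in the first one; in
each of these three blocks the second configuration has its own edge densities. The second state of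
a vertex has at most as much entropy given the edge type as given its own first state alone. Hence f
is at most Φ(α, β, 1 - α - β) plus the values of Φ on the three blocks
(`secondMomentExponent_le_blocks`). At the product point all blocks have relative densities (α, β),
and f = 2Φ.

At (α, β) = (p⁻, p⁺) the normalized Φ has its maximum K, so f ≤ 2K by homogeneity. Equality forces
each block to have densities (p⁻, p⁺) or the reverse; the left densities average to p⁻ < p⁺, so none
is reversed (`eq_product_of_le`).

The maximum of Φ: Gibbs' inequality bounds Φ by the logarithm of `pairWeight` at the sixth roots of
the odds. By Hölder, `pairWeight x` is maximal at the image of x under the tree recursion, so maxima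
sit on two-cycles. Rolle leaves only s, t and the fixed point z as two-cycle points, and a numerical
comparison discards z (`pairWeight_le`).

For nearby (α, β), Φ need not be maximal there, but it is strongly concave on a box. Tangent bounds
summed over the blocks lose their linear parts, because the block densities average to α and β; this
settles a whole neighbourhood of the product point (`eq_product_of_le_of_box`). Compactness and
continuity settle the rest (`eventually_attainsUniqueMaxAt`). -/

/-! ### Independent sets of the regular tree and their recursion -/

/-- The words that may follow the letter `o` (no constraint for `o = none`). -/
def IsWordAfter {d : ℕ} (o : Option (Fin d)) (w : List (Fin d)) : Prop :=
  (o.toList ++ w).IsChain (· ≠ ·)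

theorem isWordAfter_nil {d : ℕ} (o : Option (Fin d)) : IsWordAfter o [] := by
  cases o <;> simp [IsWordAfter]

theorem isWordAfter_cons {d : ℕ} (o : Option (Fin d)) (b : Fin d) (w : List (Fin d)) :
    IsWordAfter o (b :: w) ↔ b ∉ o ∧ IsWordAfter (some b) w := by
  cases o with
  | none => simp [IsWordAfter]
  | some a => simp [IsWordAfter]

/-- Independent sets of the tree of words of length at most `n` that may follow `o`, with
level `n` completely occupied. -/
structure IsFullIndep {d : ℕ} (o : Option (Fin d)) (n : ℕ) (S : Set (List (Fin d))) : Prop where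
  word : ∀ w ∈ S, IsWordAfter o w ∧ w.length ≤ n
  indep : ∀ w a, w ∈ S → w ++ [a] ∉ S
  full : ∀ w, IsWordAfter o w → w.length = n → w ∈ S

/-- The trace of `S` on the subtree of the words that begin with `b`. -/
def childSet {d : ℕ} (b : Fin d) (S : Set (List (Fin d))) : Set (List (Fin d)) :=
  {w | b :: w ∈ S}

/-- Edges append a letter at the end of a word, so stripping the first letter preserves adjacency
inside each branch; the only other edges join the root to its children. -/
theorem isFullIndep_succ_iff {d : ℕ} (o : Option (Fin d)) (n : ℕ) (S : Set (List (Fin d))) :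
    IsFullIndep o (n + 1) S ↔
      (∀ b, b ∉ o → IsFullIndep (some b) n (childSet b S)) ∧
      (∀ b ∈ o, ∀ w, b :: w ∉ S) ∧ ([] ∈ S → ∀ b, [b] ∉ S) := by
  constructor
  · intro h
    refine ⟨fun b hb => ⟨fun w hw => ?_, fun w a hw => ?_, fun w hw hl => ?_⟩,
      fun b hb w hw => ?_, fun h0 b => ?_⟩
    · have := h.word _ hw
      rw [isWordAfter_cons] at this
      exact ⟨this.1.2, by simpa using this.2⟩
    · exact h.indep (b :: w) a hw
    · exact h.full (b :: w) ((isWordAfter_cons _ _ _).2 ⟨hb, hw⟩) (by simp [hl])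
    · exact ((isWordAfter_cons _ _ _).1 (h.word _ hw).1).1 hb
    · exact h.indep [] b h0
  · rintro ⟨h1, h2, h3⟩
    refine ⟨fun w hw => ?_, fun w a hw => ?_, fun w hw hl => ?_⟩
    · cases w with
      | nil => exact ⟨isWordAfter_nil o, by simp⟩
      | cons b w =>
        have hb : b ∉ o := fun hb => h2 b hb w hw
        have := (h1 b hb).word w hw
        exact ⟨(isWordAfter_cons _ _ _).2 ⟨hb, this.1⟩, by simpa using this.2⟩
    · cases w with
      | nil => exact h3 hw a
      | cons b w =>
        have hb : b ∉ o := fun hb => h2 b hb w hw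
        exact (h1 b hb).indep w a hw
    · cases w with
      | nil => simp at hl
      | cons b w =>
        rw [isWordAfter_cons] at hw
        exact (h1 b hw.1).full w hw.2 (by simpa using hl)

/-- The set of words with prescribed root and prescribed traces on the subtrees. -/
def glueSet {d : ℕ} (o : Option (Fin d)) (r : Prop) (f : {b // b ∉ o} → Set (List (Fin d))) :
    Set (List (Fin d)) :=
  {w | match w with
    | [] => r
    | b :: w => ∃ h : b ∉ o, w ∈ f ⟨b, h⟩}

theorem childSet_glueSet {d : ℕ} (o : Option (Fin d)) (r : Prop)
    (f : {b // b ∉ o} → Set (List (Fin d))) (b : Fin d) (hb : b ∉ o) :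
    childSet b (glueSet o r f) = f ⟨b, hb⟩ := by
  ext w
  exact ⟨fun ⟨_, h⟩ => h, fun h => ⟨hb, h⟩⟩

theorem glueSet_childSet {d : ℕ} (o : Option (Fin d)) (r : Prop) (S : Set (List (Fin d)))
    (hr : [] ∈ S ↔ r) (h : ∀ b ∈ o, ∀ w, b :: w ∉ S) :
    glueSet o r (fun b => childSet b.1 S) = S := by
  ext w
  cases w with
  | nil => exact hr.symm
  | cons b w =>
    simp only [glueSet, childSet, Set.mem_ofPred_eq]
    exact ⟨fun ⟨_, h'⟩ => h', fun h' => ⟨fun hb => h b hb w h', h'⟩⟩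

/-- Sets with unoccupied root correspond to families of arbitrary sets on the subtrees. -/
def emptyRootEquiv {d : ℕ} (o : Option (Fin d)) (n : ℕ) :
    {S : Set (List (Fin d)) // IsFullIndep o (n + 1) S ∧ [] ∉ S} ≃
      ((b : {b // b ∉ o}) → {S : Set (List (Fin d)) // IsFullIndep (some b.1) n S}) where
  toFun S b := ⟨childSet b.1 S.1, ((isFullIndep_succ_iff o n S.1).1 S.2.1).1 b.1 b.2⟩
  invFun f := ⟨glueSet o False fun b => (f b).1, by
    refine ⟨(isFullIndep_succ_iff _ _ _).2 ⟨fun b hb => ?_, fun b hb w hw => ?_, ?_⟩, id⟩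
    · rw [childSet_glueSet _ _ _ b hb]; exact (f ⟨b, hb⟩).2
    · exact hw.1 hb
    · exact fun h => h.elim⟩
  left_inv S := Subtype.ext (glueSet_childSet o False S.1 (by simpa using S.2.2)
    ((isFullIndep_succ_iff o n S.1).1 S.2.1).2.1)
  right_inv f := by
    funext b
    exact Subtype.ext (childSet_glueSet o False (fun b => (f b).1) b.1 b.2)

/-- Sets with occupied root correspond to families of sets with unoccupied root on the subtrees. -/
def fullRootEquiv {d : ℕ} (o : Option (Fin d)) (n : ℕ) :
    {S : Set (List (Fin d)) // IsFullIndep o (n + 1) S ∧ [] ∈ S} ≃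
      ((b : {b // b ∉ o}) →
        {S : Set (List (Fin d)) // IsFullIndep (some b.1) n S ∧ [] ∉ S}) where
  toFun S b := ⟨childSet b.1 S.1, ((isFullIndep_succ_iff o n S.1).1 S.2.1).1 b.1 b.2,
    ((isFullIndep_succ_iff o n S.1).1 S.2.1).2.2 S.2.2 b.1⟩
  invFun f := ⟨glueSet o True fun b => (f b).1, by
    refine ⟨(isFullIndep_succ_iff _ _ _).2 ⟨fun b hb => ?_, fun b hb w hw => ?_, ?_⟩, trivial⟩
    · rw [childSet_glueSet _ _ _ b hb]; exact (f ⟨b, hb⟩).2.1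
    · exact hw.1 hb
    · rintro - b ⟨hb, hw⟩
      exact (f ⟨b, hb⟩).2.2 hw⟩
  left_inv S := Subtype.ext (glueSet_childSet o True S.1 (by simpa using S.2.2)
    ((isFullIndep_succ_iff o n S.1).1 S.2.1).2.1)
  right_inv f := by
    funext b
    exact Subtype.ext (childSet_glueSet o True (fun b => (f b).1) b.1 b.2)

theorem finite_setOf_isFullIndep {d : ℕ} (o : Option (Fin d)) (n : ℕ) :
    {S : Set (List (Fin d)) | IsFullIndep o n S}.Finite :=
  (List.finite_length_le (Fin d) n).finite_subsets.subset fun _ hS w hw => (hS.word w hw).2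

/-- The number of sets with unoccupied root. -/
noncomputable def emptyCount {d : ℕ} (o : Option (Fin d)) (n : ℕ) : ℕ :=
  Nat.card {S : Set (List (Fin d)) // IsFullIndep o n S ∧ [] ∉ S}

/-- The number of sets with occupied root. -/
noncomputable def fullCount {d : ℕ} (o : Option (Fin d)) (n : ℕ) : ℕ :=
  Nat.card {S : Set (List (Fin d)) // IsFullIndep o n S ∧ [] ∈ S}

theorem card_isFullIndep {d : ℕ} (o : Option (Fin d)) (n : ℕ) :
    Nat.card {S : Set (List (Fin d)) // IsFullIndep o n S} = emptyCount o n + fullCount o n := by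
  have h := finite_setOf_isFullIndep o n
  have e : {S : Set (List (Fin d)) | IsFullIndep o n S} =
      {S | IsFullIndep o n S ∧ [] ∉ S} ∪ {S | IsFullIndep o n S ∧ [] ∈ S} := by
    ext S; simp only [Set.mem_ofPred_eq, Set.mem_union]; tauto
  have := Set.ncard_union_eq (s := {S | IsFullIndep o n S ∧ [] ∉ S})
    (t := {S | IsFullIndep o n S ∧ [] ∈ S})
    (Set.disjoint_left.2 fun S h1 h2 => h1.2 h2.2)
    (h.subset fun S h => h.1) (h.subset fun S h => h.1)
  rw [← e] at this
  exact this

theorem emptyCount_succ {d : ℕ} (o : Option (Fin d)) (n : ℕ) :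
    emptyCount o (n + 1) =
      ∏ b : {b // b ∉ o}, (emptyCount (some b.1) n + fullCount (some b.1) n) := by
  rw [emptyCount, Nat.card_congr (emptyRootEquiv o n), Nat.card_pi]
  simp only [card_isFullIndep]

theorem fullCount_succ {d : ℕ} (o : Option (Fin d)) (n : ℕ) :
    fullCount o (n + 1) = ∏ b : {b // b ∉ o}, emptyCount (some b.1) n := by
  rw [fullCount, Nat.card_congr (fullRootEquiv o n), Nat.card_pi]
  rfl

theorem emptyCount_zero {d : ℕ} (o : Option (Fin d)) : emptyCount o 0 = 0 := by
  have : IsEmpty {S : Set (List (Fin d)) // IsFullIndep o 0 S ∧ [] ∉ S} :=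
    ⟨fun S => S.2.2 (S.2.1.full [] (isWordAfter_nil o) rfl)⟩
  simp [emptyCount]

theorem fullCount_zero {d : ℕ} (o : Option (Fin d)) : fullCount o 0 = 1 := by
  rw [fullCount, Nat.card_eq_one_iff_exists]
  refine ⟨⟨{[]}, ⟨?_, ?_, ?_⟩, rfl⟩, ?_⟩
  · rintro w rfl; exact ⟨isWordAfter_nil o, by simp⟩
  · rintro w a - h; simp at h
  · intro w _ h; simpa using h
  · rintro ⟨S, hS, h0⟩
    refine Subtype.ext (Set.eq_singleton_iff_unique_mem.2 ⟨h0, fun w hw => ?_⟩)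
    simpa using (hS.word w hw).2

/-- The probability that the root of a branch of depth `n` is unoccupied. -/
noncomputable def vacancy : ℕ → ℝ
  | 0 => 0
  | n + 1 => 1 / (1 + vacancy n ^ 5)

theorem vacancy_nonneg (n : ℕ) : 0 ≤ vacancy n := by
  induction n with
  | zero => exact le_rfl
  | succ n ih => rw [vacancy]; positivity

/-- Symmetry in the labels, carried through the induction as the last clause, turns the products
over the five children into fifth powers. -/
theorem count_branch (b : Fin 6) (n : ℕ) :
    0 < emptyCount (some b) n + fullCount (some b) n ∧
      (emptyCount (some b) n : ℝ) =
        vacancy n * ((emptyCount (some b) n : ℝ) + fullCount (some b) n) ∧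
      ∀ c : Fin 6, emptyCount (some c) n = emptyCount (some b) n ∧
        fullCount (some c) n = fullCount (some b) n := by
  induction n generalizing b with
  | zero => simp [emptyCount_zero, fullCount_zero, vacancy]
  | succ n ih =>
    have hc : ∀ a : Fin 6, Fintype.card {b // b ∉ some a} = 5 := by
      intro a; simp [Fintype.card_subtype_compl]
    have he : ∀ a : Fin 6, emptyCount (some a) (n + 1) =
        (emptyCount (some b) n + fullCount (some b) n) ^ 5 := by
      intro a
      rw [emptyCount_succ, Finset.prod_congr rfl (fun c _ => by
        rw [((ih b).2.2 c.1).1, ((ih b).2.2 c.1).2]), Finset.prod_const, Finset.card_univ, hc]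
    have hf : ∀ a : Fin 6, fullCount (some a) (n + 1) = emptyCount (some b) n ^ 5 := by
      intro a
      rw [fullCount_succ, Finset.prod_congr rfl (fun c _ => by rw [((ih b).2.2 c.1).1]),
        Finset.prod_const, Finset.card_univ, hc]
    obtain ⟨h1, h2, -⟩ := ih b
    refine ⟨by rw [he]; positivity, ?_, fun c => by simp [he, hf]⟩
    rw [he, hf, vacancy]
    have hv := vacancy_nonneg n
    push_cast
    nth_rewrite 3 [h2]
    have : (0 : ℝ) < emptyCount (some b) n + fullCount (some b) n := by exact_mod_cast h1
    field_simp

theorem count_root (n : ℕ) :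
    (fullCount (none : Option (Fin 6)) (n + 1) : ℝ) /
      ((emptyCount (none : Option (Fin 6)) (n + 1) : ℝ) + fullCount (none : Option (Fin 6)) (n + 1))
      = vacancy n ^ 6 / (1 + vacancy n ^ 6) := by
  obtain ⟨h1, h2, h3⟩ := count_branch 0 n
  have hc : Fintype.card {b : Fin 6 // b ∉ (none : Option (Fin 6))} = 6 := by simp
  have he : emptyCount (none : Option (Fin 6)) (n + 1) =
      (emptyCount (some (0 : Fin 6)) n + fullCount (some (0 : Fin 6)) n) ^ 6 := by
    rw [emptyCount_succ, Finset.prod_congr rfl (fun c _ => by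
      rw [(h3 c.1).1, (h3 c.1).2]), Finset.prod_const, Finset.card_univ, hc]
  have hf : fullCount (none : Option (Fin 6)) (n + 1) = emptyCount (some (0 : Fin 6)) n ^ 6 := by
    rw [fullCount_succ, Finset.prod_congr rfl (fun c _ => by rw [(h3 c.1).1]),
      Finset.prod_const, Finset.card_univ, hc]
  have hp : (0 : ℝ) < emptyCount (some (0 : Fin 6)) n + fullCount (some (0 : Fin 6)) n := by
    exact_mod_cast h1
  have hv := vacancy_nonneg n
  rw [he, hf]
  push_cast
  generalize (emptyCount (some (0 : Fin 6)) n : ℝ) + fullCount (some (0 : Fin 6)) n = s at *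
  rw [h2, mul_pow, div_eq_div_iff (by positivity) (by positivity)]
  ring

theorem hardcoreWeight_one {V : Type*} [Fintype V] (G : SimpleGraph V) (A : Set (Finset V)) :
    hardcoreWeight G 1 A =
      (Nat.card {S : Finset V // G.IsIndepSet (S : Set V) ∧ S ∈ A} : ℝ) := by
  classical
  rw [hardcoreWeight, Nat.card_eq_fintype_card, Fintype.card_subtype]
  simp

theorem hardcoreCondProb_one {V : Type*} [Fintype V] (G : SimpleGraph V) (A B : Set (Finset V)) :
    hardcoreCondProb G 1 A B =
      (Nat.card {S : Finset V // G.IsIndepSet (S : Set V) ∧ S ∈ A ∩ B} : ℝ) /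
        (Nat.card {S : Finset V // G.IsIndepSet (S : Set V) ∧ S ∈ B} : ℝ) := by
  have h : hardcoreWeight G 1 Set.univ ≠ 0 := by
    rw [hardcoreWeight_one, Nat.cast_ne_zero]
    have : Nonempty {S : Finset V // G.IsIndepSet (S : Set V) ∧ S ∈ (Set.univ : Set (Finset V))} :=
      ⟨⟨∅, by simp [SimpleGraph.IsIndepSet]⟩⟩
    exact Nat.card_pos.ne'
  rw [hardcoreCondProb, hardcoreProb, hardcoreProb, div_div_div_cancel_right₀ h,
    hardcoreWeight_one, hardcoreWeight_one]

/-- The set of words of a set of vertices of a ball. -/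
def wordSet {d n : ℕ} (S : Finset (treeBall d n)) : Set (List (Fin d)) :=
  {w | ∃ v ∈ S, v.1.1 = w}

theorem mem_wordSet {d n : ℕ} (S : Finset (treeBall d n)) (v : treeBall d n) :
    v.1.1 ∈ wordSet S ↔ v ∈ S := by
  refine ⟨?_, fun h => ⟨v, h, rfl⟩⟩
  rintro ⟨u, hu, h⟩
  rwa [← Subtype.ext (Subtype.ext h : u.1 = v.1)]

theorem isFullIndep_wordSet_iff {d n : ℕ} (S : Finset (treeBall d n)) :
    IsFullIndep none n (wordSet S) ↔
      ((regularTree d).induce (treeBall d n)).IsIndepSet (S : Set (treeBall d n)) ∧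
        ∀ v : treeBall d n, treeLevel (v : TreeVertex d) = n → v ∈ S := by
  constructor
  · intro h
    refine ⟨fun u hu v hv huv hadj => ?_, fun v hv => ?_⟩
    · simp only [SimpleGraph.comap_adj, regularTree, SimpleGraph.fromRel_adj] at hadj
      obtain ⟨-, ⟨a, ha⟩ | ⟨a, ha⟩⟩ := hadj
      · exact h.indep u.1.1 a ⟨u, hu, rfl⟩ ⟨v, hv, ha⟩
      · exact h.indep v.1.1 a ⟨v, hv, rfl⟩ ⟨u, hu, ha⟩
    · exact (mem_wordSet S v).1 (h.full _ v.1.2 hv)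
  · rintro ⟨h1, h2⟩
    refine ⟨?_, ?_, fun w hw hl => ?_⟩
    · rintro _ ⟨v, -, rfl⟩
      exact ⟨v.1.2, v.2⟩
    · rintro _ a ⟨u, hu, rfl⟩ ⟨v, hv, hvu⟩
      have hne : u.1 ≠ v.1 := fun h => by
        rw [← h] at hvu
        simpa using congrArg List.length hvu
      refine h1 hu hv (fun h => hne (congrArg _ h)) ?_
      simp only [SimpleGraph.comap_adj, regularTree, SimpleGraph.fromRel_adj]
      exact ⟨hne, Or.inl ⟨a, hvu⟩⟩
    · exact ⟨⟨⟨w, hw⟩, hl.le⟩, h2 _ hl, rfl⟩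

theorem wordSet_injective {d n : ℕ} :
    Function.Injective (wordSet : Finset (treeBall d n) → Set (List (Fin d))) := by
  intro S T h
  ext v
  rw [← mem_wordSet, ← mem_wordSet, h]

theorem exists_wordSet_eq {d n : ℕ} (T : Set (List (Fin d))) (hT : IsFullIndep none n T) :
    ∃ S : Finset (treeBall d n), wordSet S = T := by
  classical
  refine ⟨Finset.univ.filter fun v => v.1.1 ∈ T, Set.ext fun w => ⟨?_, fun hw => ?_⟩⟩
  · rintro ⟨v, hv, rfl⟩
    simpa using hv
  · exact ⟨⟨⟨w, (hT.word w hw).1⟩, (hT.word w hw).2⟩, by simpa using hw, rfl⟩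

theorem card_finset_treeBall {d n : ℕ} (p : Finset (treeBall d n) → Prop)
    (q : Set (List (Fin d)) → Prop) (hq : ∀ T, q T → IsFullIndep none n T)
    (h : ∀ S, p S ↔ q (wordSet S)) :
    Nat.card {S // p S} = Nat.card {T // q T} := by
  refine Nat.card_eq_of_bijective (fun S => ⟨wordSet S.1, (h S.1).1 S.2⟩) ⟨fun S T hST => ?_, ?_⟩
  · exact Subtype.ext (wordSet_injective (congrArg Subtype.val hST))
  · rintro ⟨T, hT⟩
    obtain ⟨S, rfl⟩ := exists_wordSet_eq T (hq T hT)
    exact ⟨⟨S, (h S).2 hT⟩, rfl⟩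

theorem rootDensity_succ (n : ℕ) :
    rootDensity 6 1 (n + 1) = vacancy n ^ 6 / (1 + vacancy n ^ 6) := by
  rw [rootDensity, hardcoreCondProb_one, ← count_root,
    card_finset_treeBall _ (fun T => IsFullIndep none (n + 1) T ∧ [] ∈ T) (fun T h => h.1) ?_,
    card_finset_treeBall _ (fun T => IsFullIndep none (n + 1) T) (fun T h => h) ?_,
    card_isFullIndep, Nat.cast_add]
  · rfl
  · intro S
    exact (isFullIndep_wordSet_iff S).symm
  · intro S
    rw [isFullIndep_wordSet_iff]
    have : [] ∈ wordSet S ↔ ∃ v ∈ S, (v : TreeVertex 6) = treeRoot 6 :=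
      ⟨fun ⟨v, hv, h⟩ => ⟨v, hv, Subtype.ext h⟩, fun ⟨v, hv, h⟩ => ⟨v, hv, congrArg _ h⟩⟩
    rw [this]
    simp only [Set.mem_inter_iff, Set.mem_ofPred_eq]
    tauto

/-! ### The tree recursion and its fixed points -/

/-- The recursion of `vacancy`. -/
noncomputable def branchMap (x : ℝ) : ℝ := 1 / (1 + x ^ 5)

theorem branchMap_pos {x : ℝ} (hx : 0 ≤ x) : 0 < branchMap x := by
  unfold branchMap; positivity

theorem branchMap_le_one {x : ℝ} (hx : 0 ≤ x) : branchMap x ≤ 1 := by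
  unfold branchMap
  rw [div_le_one (by positivity)]
  have : 0 ≤ x ^ 5 := by positivity
  linarith

theorem branchMap_anti {x y : ℝ} (hx : 0 ≤ x) (h : x ≤ y) : branchMap y ≤ branchMap x := by
  unfold branchMap; gcongr

theorem branchMap_branchMap_mono {x y : ℝ} (hx : 0 ≤ x) (h : x ≤ y) :
    branchMap (branchMap x) ≤ branchMap (branchMap y) :=
  branchMap_anti (branchMap_pos (hx.trans h)).le (branchMap_anti hx h)

theorem continuousOn_branchMap : ContinuousOn branchMap (Set.Ici 0) := by
  unfold branchMap
  refine continuousOn_const.div (by fun_prop) fun x hx => ?_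
  have : (0 : ℝ) ≤ x := hx
  positivity

theorem vacancy_even_succ (l : ℕ) :
    vacancy (2 * (l + 1)) = branchMap (branchMap (vacancy (2 * l))) := rfl

theorem vacancy_even_le_succ (l : ℕ) : vacancy (2 * l) ≤ vacancy (2 * (l + 1)) := by
  induction l with
  | zero => exact vacancy_nonneg _
  | succ l ih =>
    rw [vacancy_even_succ l, vacancy_even_succ (l + 1)]
    exact branchMap_branchMap_mono (vacancy_nonneg _) ih

theorem vacancy_even_le (l : ℕ) : vacancy (2 * l) ≤ 58 / 100 := by
  induction l with
  | zero => norm_num [vacancy]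
  | succ l ih =>
    rw [vacancy_even_succ]
    -- The twofold recursion is increasing and maps 0.58 below itself.
    refine (branchMap_branchMap_mono (vacancy_nonneg _) ih).trans ?_
    norm_num [branchMap]

/-- The increasing twofold map improves a lower bound of its fixed point; iterating from 0 locates
s. -/
theorem le_of_branchMap_branchMap_eq {x q r : ℝ} (hq : 0 ≤ q) (hx : branchMap (branchMap x) = x)
    (h : q ≤ x) (hr : r ≤ branchMap (branchMap q)) : r ≤ x :=
  hr.trans ((branchMap_branchMap_mono hq h).trans hx.le)

/-- The recursion has a two-cycle whose values give the two extremal densities. -/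
theorem exists_areExtremalDensities : ∃ s t : ℝ, 57 / 100 ≤ s ∧ s ≤ 58 / 100 ∧
    branchMap s = t ∧ branchMap t = s ∧
    AreExtremalDensities 6 1 (t ^ 6 / (1 + t ^ 6)) (s ^ 6 / (1 + s ^ 6)) := by
  have hmono : Monotone fun l : ℕ => vacancy (2 * l) := monotone_nat_of_le_succ vacancy_even_le_succ
  have hbdd : BddAbove (Set.range fun l : ℕ => vacancy (2 * l)) :=
    ⟨58 / 100, by rintro _ ⟨l, rfl⟩; exact vacancy_even_le l⟩
  obtain ⟨s, hs⟩ : ∃ s, Tendsto (fun l : ℕ => vacancy (2 * l)) atTop (𝓝 s) :=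
    ⟨_, tendsto_atTop_ciSup hmono hbdd⟩
  have hs0 : 0 ≤ s := ge_of_tendsto' hs fun l => vacancy_nonneg _
  have hodd : Tendsto (fun l : ℕ => vacancy (2 * l + 1)) atTop (𝓝 (branchMap s)) := by
    have := (continuousOn_branchMap s hs0).tendsto.comp
      (tendsto_nhdsWithin_iff.2 ⟨hs, Eventually.of_forall fun l => vacancy_nonneg (2 * l)⟩)
    exact this
  have ht0 := branchMap_pos hs0
  have heven : Tendsto (fun l : ℕ => vacancy (2 * (l + 1))) atTop
      (𝓝 (branchMap (branchMap s))) := by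
    have := (continuousOn_branchMap _ ht0.le).tendsto.comp
      (tendsto_nhdsWithin_iff.2 ⟨hodd, Eventually.of_forall fun l => vacancy_nonneg (2 * l + 1)⟩)
    exact this
  have hfix : branchMap (branchMap s) = s :=
    tendsto_nhds_unique heven ((tendsto_add_atTop_iff_nat 1).2 hs)
  have hlow : 57 / 100 ≤ s := by
    have step := @le_of_branchMap_branchMap_eq s
    have h1 : 0.5 ≤ s := step le_rfl hfix hs0 (by norm_num [branchMap])
    have h2 : 0.538 ≤ s := step (by norm_num) hfix h1 (by norm_num [branchMap])
    have h3 : 0.554 ≤ s := step (by norm_num) hfix h2 (by norm_num [branchMap])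
    have h4 : 0.563 ≤ s := step (by norm_num) hfix h3 (by norm_num [branchMap])
    have h5 : 0.568 ≤ s := step (by norm_num) hfix h4 (by norm_num [branchMap])
    exact step (by norm_num) hfix h5 (by norm_num [branchMap])
  refine ⟨s, _, hlow, le_of_tendsto' hs vacancy_even_le, rfl, hfix, ?_, ?_⟩
  -- A root above level 2(l + 1) has branches of depth 2l + 1, so conditioning on even levels yields
  -- the odd limit t.
  · refine (tendsto_add_atTop_iff_nat 1).1 ?_
    have : ∀ l : ℕ, rootDensity 6 1 (2 * (l + 1)) =
        vacancy (2 * l + 1) ^ 6 / (1 + vacancy (2 * l + 1) ^ 6) :=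
      fun l => rootDensity_succ (2 * l + 1)
    simp only [this]
    exact (hodd.pow 6).div (tendsto_const_nhds.add (hodd.pow 6)) (by positivity)
  · simp only [rootDensity_succ]
    exact (hs.pow 6).div (tendsto_const_nhds.add (hs.pow 6)) (by positivity)

/-- The logarithmic form of the equation of the two-cycles. -/
noncomputable def cycleLog (x : ℝ) : ℝ :=
  Real.log (1 - x) + 5 * Real.log (1 + x ^ 5) - Real.log x

theorem cycleLog_eq_zero {x : ℝ} (hx : 0 < x) (h : branchMap (branchMap x) = x) :
    x < 1 ∧ cycleLog x = 0 := by
  have hA : (0 : ℝ) < 1 + x ^ 5 := by positivity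
  have h1 : (1 - x) * (1 + x ^ 5) ^ 5 = x := by
    unfold branchMap at h
    rw [div_pow, one_pow] at h
    field_simp at h
    linarith
  have hx1 : 0 < 1 - x := by
    by_contra hc
    have : (1 - x) * (1 + x ^ 5) ^ 5 ≤ 0 := mul_nonpos_of_nonpos_of_nonneg (by linarith)
      (by positivity)
    linarith
  refine ⟨by linarith, ?_⟩
  have := congrArg Real.log h1
  rw [Real.log_mul hx1.ne' (by positivity), Real.log_pow] at this
  unfold cycleLog
  push_cast at this
  linarith

/-- The logarithm is taken to make the derivative rational: on (0, 1) its sign is that of a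
trinomial whose own derivative vanishes only at 4/5 among positive reals. -/
theorem hasDerivAt_cycleLog {x : ℝ} (hx : 0 < x) (hx1 : x < 1) :
    HasDerivAt cycleLog ((-1 + 24 * x ^ 5 - 25 * x ^ 6) / (x * (1 - x) * (1 + x ^ 5))) x := by
  have hA : (0 : ℝ) < 1 + x ^ 5 := by positivity
  have h1 : HasDerivAt (fun x : ℝ => 1 - x) (-1) x := (hasDerivAt_id x).const_sub 1
  have h2 : HasDerivAt (fun x : ℝ => 1 + x ^ 5) (5 * x ^ 4) x := by
    simpa using (hasDerivAt_pow 5 x).const_add 1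
  have hx1' : 1 - x ≠ 0 := by linarith
  have := ((h1.log hx1').add ((h2.log hA.ne').const_mul 5)).sub (Real.hasDerivAt_log hx.ne')
  refine this.congr_deriv ?_
  field_simp
  ring

/-- Rolle's theorem, twice: the recursion has at most three two-cycle points. -/
theorem cycleLog_no_four_zeros {a b c e : ℝ} (ha : 0 < a) (hab : a < b) (hbc : b < c) (hce : c < e)
    (he : e < 1) (h1 : cycleLog a = 0) (h2 : cycleLog b = 0) (h3 : cycleLog c = 0)
    (h4 : cycleLog e = 0) : False := by
  have rolle : ∀ x y : ℝ, 0 < x → x < y → y < 1 → cycleLog x = 0 → cycleLog y = 0 →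
      ∃ z ∈ Set.Ioo x y, -1 + 24 * z ^ 5 - 25 * z ^ 6 = 0 := by
    intro x y hx hxy hy hfx hfy
    obtain ⟨z, hz, h⟩ := exists_hasDerivAt_eq_zero hxy
      (fun w hw => (hasDerivAt_cycleLog (hx.trans_le hw.1)
        (hw.2.trans_lt hy)).continuousAt.continuousWithinAt)
      (hfx.trans hfy.symm)
      (fun w hw => hasDerivAt_cycleLog (hx.trans hw.1) (hw.2.trans hy))
    refine ⟨z, hz, ?_⟩
    have hz0 : 0 < z := hx.trans hz.1
    have hz1 : 0 < 1 - z := by linarith [hz.2]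
    rcases div_eq_zero_iff.1 h with h | h
    · exact h
    · have : 0 < z * (1 - z) * (1 + z ^ 5) := by positivity
      linarith
  have rolle' : ∀ x y : ℝ, 0 < x → x < y → -1 + 24 * x ^ 5 - 25 * x ^ 6 = 0 →
      -1 + 24 * y ^ 5 - 25 * y ^ 6 = 0 → 4 / 5 ∈ Set.Ioo x y := by
    intro x y hx hxy hfx hfy
    obtain ⟨z, hz, h⟩ := exists_hasDerivAt_eq_zero
      (f := fun z : ℝ => -1 + 24 * z ^ 5 - 25 * z ^ 6)
      (f' := fun z => 30 * z ^ 4 * (4 - 5 * z)) hxy (by fun_prop) (hfx.trans hfy.symm) (fun w hw => by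
        have := (((hasDerivAt_pow 5 w).const_mul 24).const_add (-1)).sub
          ((hasDerivAt_pow 6 w).const_mul 25)
        refine this.congr_deriv ?_
        push_cast
        ring)
    have hz0 : 0 < z := hx.trans hz.1
    have : (4 : ℝ) / 5 = z := by
      rcases mul_eq_zero.1 h with h | h
      · have : 0 < 30 * z ^ 4 := by positivity
        linarith
      · linarith
    rwa [this]
  obtain ⟨u, hu, hu'⟩ := rolle a b ha hab (hbc.trans (hce.trans he)) h1 h2
  obtain ⟨v, hv, hv'⟩ := rolle b c (ha.trans hab) hbc (hce.trans he) h2 h3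
  obtain ⟨w, hw, hw'⟩ := rolle c e (ha.trans (hab.trans hbc)) hce he h3 h4
  -- The point 4/5 would lie on both sides of v.
  have m1 := rolle' u v (ha.trans hu.1) (hu.2.trans hv.1) hu' hv'
  have m2 := rolle' v w (ha.trans (hab.trans hv.1)) (hv.2.trans hw.1) hv' hw'
  exact absurd m1.2 (not_lt.2 m2.1.le)

theorem exists_fixedPoint : ∃ z : ℝ, 778 / 1000 ≤ z ∧ z ≤ 7785 / 10000 ∧ branchMap z = z := by
  have hc : ContinuousOn (fun z : ℝ => z ^ 6 + z) (Set.Icc (778 / 1000) (7785 / 10000)) := by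
    fun_prop
  obtain ⟨z, hz, h⟩ := intermediate_value_Icc (by norm_num) hc
    (show (1 : ℝ) ∈ Set.Icc _ _ by norm_num)
  refine ⟨z, hz.1, hz.2, ?_⟩
  have hz0 : 0 < z := lt_of_lt_of_le (by norm_num) hz.1
  unfold branchMap
  rw [div_eq_iff (by positivity)]
  simp only at h
  linarith

/-- Already s < z < t are three zeros of `cycleLog`; wherever another x falls, there would be four.
-/
theorem branchMap_two_cycle {s t z x : ℝ} (hs : 57 / 100 ≤ s) (hs' : s ≤ 58 / 100)
    (hst : branchMap s = t) (hts : branchMap t = s) (hz : 778 / 1000 ≤ z) (hz' : z ≤ 7785 / 10000)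
    (hzz : branchMap z = z) (hx : 0 ≤ x) (hxx : branchMap (branchMap x) = x) :
    x = s ∨ x = t ∨ x = z := by
  have hx0 : 0 < x := hxx ▸ branchMap_pos (branchMap_pos hx).le
  have ht : 9 / 10 ≤ t := by
    rw [← hst]
    refine le_trans ?_ (branchMap_anti (by linarith) hs')
    norm_num [branchMap]
  obtain ⟨-, s0⟩ := cycleLog_eq_zero (x := s) (by linarith) (by rw [hst, hts])
  obtain ⟨t1, t0⟩ := cycleLog_eq_zero (x := t) (by linarith) (by rw [hts, hst])
  obtain ⟨-, z0⟩ := cycleLog_eq_zero (x := z) (by linarith) (by rw [hzz, hzz])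
  obtain ⟨x1, x0⟩ := cycleLog_eq_zero hx0 hxx
  have hsz : s < z := by linarith
  have hzt : z < t := by linarith
  have hs0 : 0 < s := by linarith
  by_contra! hne
  rcases lt_or_gt_of_ne hne.1 with h | h
  · exact cycleLog_no_four_zeros hx0 h hsz hzt t1 x0 s0 z0 t0
  rcases lt_or_gt_of_ne hne.2.2 with h' | h'
  · exact cycleLog_no_four_zeros hs0 h h' hzt t1 s0 x0 z0 t0
  rcases lt_or_gt_of_ne hne.2.1 with h'' | h''
  · exact cycleLog_no_four_zeros hs0 hsz h' h'' t1 s0 z0 x0 t0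
  · exact cycleLog_no_four_zeros hs0 hsz hzt h'' x1 s0 z0 t0 x0

/-! ### The first moment -/

/-- The exponential of the first moment exponent, in the variables of the tree recursion. -/
noncomputable def pairWeight (x y : ℝ) : ℝ :=
  (1 + x ^ 5 + y ^ 5) ^ 6 / ((1 + x ^ 6) ^ 5 * (1 + y ^ 6) ^ 5)

/-- The maximum of `pairWeight x` over the second variable. -/
noncomputable def singleWeight (x : ℝ) : ℝ := (1 + (1 + x ^ 5) ^ 6) / (1 + x ^ 6) ^ 5

theorem pairWeight_comm (x y : ℝ) : pairWeight x y = pairWeight y x := by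
  unfold pairWeight
  rw [add_right_comm, mul_comm]

/-- Hölder's inequality with exponents 6 and 6/5 for A · 1 + 1 · y⁵, with its equality case. -/
theorem one_add_pow_mul_ge {A y : ℝ} (hA : 0 < A) (hy : 0 ≤ y) :
    (A + y ^ 5) ^ 6 ≤ (1 + A ^ 6) * (1 + y ^ 6) ^ 5 ∧
      ((A + y ^ 5) ^ 6 = (1 + A ^ 6) * (1 + y ^ 6) ^ 5 → y = 1 / A) := by
  obtain ⟨m, hm⟩ : ∃ m, m = (A + y ^ 5) / (1 + y ^ 6) := ⟨_, rfl⟩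
  have hm0 : 0 < m := by rw [hm]; positivity
  have hY : 0 < 1 + y ^ 6 := by positivity
  have hmY : A + y ^ 5 = m * (1 + y ^ 6) := by rw [hm]; field_simp
  -- The sum of two AM-GM defects: A⁶ + 5m⁶ - 6Am⁵ and, with u = ym, 1 + 5u⁶ - 6u⁵. Each has a
  -- double root, at A = m and at u = 1.
  have key : (1 + A ^ 6) * (1 + y ^ 6) ^ 5 - (A + y ^ 5) ^ 6 =
      (1 + y ^ 6) ^ 5 * ((A - m) ^ 2 *
        (A ^ 4 + 2 * A ^ 3 * m + 3 * A ^ 2 * m ^ 2 + 4 * A * m ^ 3 + 5 * m ^ 4) +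
        (y * m - 1) ^ 2 *
          (5 * (y * m) ^ 4 + 4 * (y * m) ^ 3 + 3 * (y * m) ^ 2 + 2 * (y * m) + 1)) := by
    have e : A = m * (1 + y ^ 6) - y ^ 5 := by linarith
    rw [hmY, mul_pow, e]
    ring
  have p1 : 0 < A ^ 4 + 2 * A ^ 3 * m + 3 * A ^ 2 * m ^ 2 + 4 * A * m ^ 3 + 5 * m ^ 4 := by
    positivity
  have p2 : 0 < 5 * (y * m) ^ 4 + 4 * (y * m) ^ 3 + 3 * (y * m) ^ 2 + 2 * (y * m) + 1 := by
    positivity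
  refine ⟨?_, fun h => ?_⟩
  · rw [← sub_nonneg, key]; positivity
  · rw [← h, sub_self] at key
    have hz := (mul_eq_zero.1 key.symm).resolve_left (by positivity)
    have q1 := mul_nonneg (sq_nonneg (A - m)) p1.le
    have q2 := mul_nonneg (sq_nonneg (y * m - 1)) p2.le
    have r1 := (mul_eq_zero.1 (by linarith : (A - m) ^ 2 * _ = 0)).resolve_right p1.ne'
    have r2 := (mul_eq_zero.1 (by linarith : (y * m - 1) ^ 2 * _ = 0)).resolve_right p2.ne'
    have r1' : A = m := by linarith [pow_eq_zero_iff (two_ne_zero) |>.1 r1]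
    have r2' : y * m = 1 := by linarith [pow_eq_zero_iff (two_ne_zero) |>.1 r2]
    rw [eq_div_iff hA.ne', r1', r2']

theorem pairWeight_le_singleWeight {x y : ℝ} (hx : 0 ≤ x) (hy : 0 ≤ y) :
    pairWeight x y ≤ singleWeight x ∧ (pairWeight x y = singleWeight x → y = branchMap x) := by
  obtain ⟨h1, h2⟩ := one_add_pow_mul_ge (A := 1 + x ^ 5) (by positivity) hy
  have hX : 0 < (1 + x ^ 6) ^ 5 := by positivity
  have hY : 0 < (1 + y ^ 6) ^ 5 := by positivity
  have e : singleWeight x =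
      ((1 + (1 + x ^ 5) ^ 6) * (1 + y ^ 6) ^ 5) / ((1 + x ^ 6) ^ 5 * (1 + y ^ 6) ^ 5) := by
    unfold singleWeight
    rw [mul_div_mul_right _ _ hY.ne']
  rw [e, pairWeight]
  refine ⟨by gcongr, fun h => h2 ?_⟩
  rwa [div_left_inj' (by positivity)] at h

theorem pairWeight_branchMap {x : ℝ} (hx : 0 ≤ x) : pairWeight x (branchMap x) = singleWeight x := by
  have hA : 0 < 1 + x ^ 5 := by positivity
  unfold pairWeight singleWeight branchMap
  generalize 1 + x ^ 5 = A at *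
  field_simp
  ring

/-- The symmetric `pairWeight` at x and its image equals `singleWeight x`; optimizing over the other
argument can only increase it. -/
theorem singleWeight_le_branchMap {x : ℝ} (hx : 0 ≤ x) :
    singleWeight x ≤ singleWeight (branchMap x) ∧
      (singleWeight x = singleWeight (branchMap x) → branchMap (branchMap x) = x) := by
  rw [← pairWeight_branchMap hx, pairWeight_comm]
  obtain ⟨h1, h2⟩ := pairWeight_le_singleWeight (branchMap_pos hx).le hx
  exact ⟨h1, fun h => (h2 h).symm⟩

/-- `pairWeight` is maximal exactly at the two-cycle of the tree recursion. -/
theorem pairWeight_le {s t : ℝ} (hs : 57 / 100 ≤ s) (hs' : s ≤ 58 / 100)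
    (hst : branchMap s = t) (hts : branchMap t = s) {x y : ℝ} (hx : 0 ≤ x) (hy : 0 ≤ y) :
    pairWeight x y ≤ pairWeight s t ∧
      (pairWeight x y = pairWeight s t → x = s ∧ y = t ∨ x = t ∧ y = s) := by
  obtain ⟨z, hz, hz', hzz⟩ := exists_fixedPoint
  have hs0 : 0 ≤ s := by linarith
  have ht0 : 0 ≤ t := hst ▸ (branchMap_pos hs0).le
  have hK : pairWeight s t = singleWeight s := by rw [← hst, pairWeight_branchMap hs0]
  have hKt : singleWeight t = singleWeight s := by
    refine le_antisymm ?_ ?_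
    · simpa [hts] using (singleWeight_le_branchMap ht0).1
    · simpa [hst] using (singleWeight_le_branchMap hs0).1
  -- This excludes the fixed point; 57/100 is a test value near s at which `singleWeight` is
  -- rational and computable.
  have hzK : singleWeight z < singleWeight (57 / 100) := by
    have hz0 : 0 ≤ z := by linarith
    calc singleWeight z ≤ (1 + (1 + (7785 / 10000) ^ 5) ^ 6) / (1 + (778 / 1000) ^ 6) ^ 5 := by
          unfold singleWeight; gcongr
      _ < _ := by norm_num [singleWeight]
  have hcont : Continuous singleWeight := by
    unfold singleWeight
    refine Continuous.div (by fun_prop) (by fun_prop) fun x => ?_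
    have : 0 ≤ x ^ 6 := by positivity
    positivity
  obtain ⟨m, hm, hmax⟩ := (isCompact_Icc (a := (0 : ℝ)) (b := 1)).exists_isMaxOn
    ⟨0, by simp⟩ hcont.continuousOn
  have hmfix : branchMap (branchMap m) = m := by
    obtain ⟨h1, h2⟩ := singleWeight_le_branchMap hm.1
    exact h2 (le_antisymm h1
      (hmax ⟨(branchMap_pos hm.1).le, branchMap_le_one hm.1⟩))
  have hmz : singleWeight (57 / 100) ≤ singleWeight m := hmax (by norm_num)
  have hmK : singleWeight m = singleWeight s := by
    rcases branchMap_two_cycle hs hs' hst hts hz hz' hzz hm.1 hmfix with h | h | h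
    · rw [h]
    · rw [h, hKt]
    · rw [h] at hmz; linarith
  have hle : ∀ x, 0 ≤ x → singleWeight x ≤ singleWeight (branchMap x) ∧
      singleWeight (branchMap x) ≤ singleWeight s := fun x hx =>
    ⟨(singleWeight_le_branchMap hx).1,
      hmK ▸ hmax ⟨(branchMap_pos hx).le, branchMap_le_one hx⟩⟩
  obtain ⟨g1, g2⟩ := pairWeight_le_singleWeight hx hy
  obtain ⟨g3, g4⟩ := hle x hx
  rw [hK]
  refine ⟨g1.trans (g3.trans g4), fun h => ?_⟩
  have hxfix := (singleWeight_le_branchMap hx).2 (le_antisymm g3 (by linarith))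
  have hyx := g2 (by linarith)
  rcases branchMap_two_cycle hs hs' hst hts hz hz' hzz hx hxfix with h' | h' | h'
  · left; exact ⟨h', by rw [hyx, h', hst]⟩
  · right; exact ⟨h', by rw [hyx, h', hts]⟩
  · rw [← h'] at hzK; linarith

/-! ### The entropy of a block -/

/-- The first moment exponent of a block with `a` occupied left, `b` occupied right and `c`
unoccupied edges (homogeneous of degree one). -/
noncomputable def blockExponent (a b c : ℝ) : ℝ :=
  Real.negMulLog a + Real.negMulLog b + 6 * Real.negMulLog c - 5 * Real.negMulLog (b + c)
    - 5 * Real.negMulLog (a + c) + 4 * Real.negMulLog (a + b + c)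

theorem blockExponent_mul (t a b c : ℝ) :
    blockExponent (t * a) (t * b) (t * c) = t * blockExponent a b c := by
  simp only [blockExponent, ← mul_add, Real.negMulLog_mul]
  ring

/-- This is log u ≤ u - 1 at u = q / a. The last hypothesis excludes q = 0 < a, where the convention
log 0 = 0 would spoil the bound. -/
theorem negMulLog_le_gibbs {a q : ℝ} (ha : 0 ≤ a) (hq : 0 ≤ q) (h : a ≠ 0 → q ≠ 0) :
    Real.negMulLog a ≤ -(a * Real.log q) + q - a := by
  rcases ha.eq_or_lt with rfl | ha
  · simpa using hq
  have hq : 0 < q := hq.lt_of_ne (h ha.ne').symm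
  have h1 := Real.log_le_sub_one_of_pos (div_pos hq ha)
  rw [Real.log_div hq.ne' ha.ne'] at h1
  have h2 := mul_le_mul_of_nonneg_left h1 ha.le
  have h3 : a * (q / a - 1) = q - a := by field_simp
  rw [h3] at h2
  rw [Real.negMulLog]
  linarith

theorem exists_pow_six_eq {x : ℝ} (hx : 0 ≤ x) : ∃ y : ℝ, 0 ≤ y ∧ y ^ 6 = x :=
  ⟨x ^ ((6 : ℕ) : ℝ)⁻¹, by positivity, Real.rpow_inv_natCast_pow hx (by norm_num)⟩

theorem negMulLog_add_negMulLog_odds {a m σ : ℝ} (hσ : 0 ≤ σ) (hm : 0 < m) (ham : a + m = 1)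
    (h : a = σ ^ 6 * m) :
    Real.negMulLog a + Real.negMulLog m = Real.log (1 + σ ^ 6) - 6 * (a * Real.log σ) := by
  have hm1 : (1 + σ ^ 6) * m = 1 := by rw [add_mul, one_mul, ← h, add_comm, ham]
  have hlm : Real.log (1 + σ ^ 6) = -Real.log m := by
    rw [eq_inv_of_mul_eq_one_left hm1, Real.log_inv]
  rcases hσ.eq_or_lt with rfl | hσ
  · have : m = 1 := by simpa using hm1
    simp [h, this]
  · have hla : Real.log a = 6 * Real.log σ + Real.log m := by
      rw [h, Real.log_mul (by positivity) hm.ne', Real.log_pow]; norm_num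
    simp only [Real.negMulLog]
    rw [hlm, hla]
    linear_combination (-Real.log m) * ham

theorem log_pairWeight {σ τ : ℝ} (hσ : 0 ≤ σ) (hτ : 0 ≤ τ) :
    Real.log (pairWeight σ τ) = 6 * Real.log (1 + σ ^ 5 + τ ^ 5) - 5 * Real.log (1 + σ ^ 6)
      - 5 * Real.log (1 + τ ^ 6) := by
  rw [pairWeight, Real.log_div (by positivity) (by positivity),
    Real.log_mul (by positivity) (by positivity), Real.log_pow, Real.log_pow, Real.log_pow]
  push_cast
  ring

/-- For total weight 1, Φ is six times the entropy of (a, b, c) minus five times the two marginal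
entropies. The marginals are exact in terms of the odds σ⁶, τ⁶; Gibbs against (σ⁵, τ⁵, 1)/D bounds
the first part, and the terms in log σ and log τ cancel. -/
theorem blockExponent_le_log_pairWeight {a b c σ τ : ℝ} (ha : 0 ≤ a) (hb : 0 ≤ b) (hc : 0 ≤ c)
    (habc : a + b + c = 1) (hbc : 0 < b + c) (hac : 0 < a + c) (hσ : 0 ≤ σ) (hτ : 0 ≤ τ)
    (haσ : a = σ ^ 6 * (b + c)) (hbτ : b = τ ^ 6 * (a + c)) :
    blockExponent a b c ≤ Real.log (pairWeight σ τ) := by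
  have h1 := negMulLog_add_negMulLog_odds hσ hbc (by linarith) haσ
  have h2 := negMulLog_add_negMulLog_odds hτ hac (by linarith) hbτ
  obtain ⟨D, hD⟩ : ∃ D, D = 1 + σ ^ 5 + τ ^ 5 := ⟨_, rfl⟩
  have hD0 : 0 < D := by rw [hD]; positivity
  have gibbs : ∀ x ρ : ℝ, 0 ≤ x → 0 ≤ ρ → (ρ = 0 → x = 0) →
      Real.negMulLog x ≤ -(5 * (x * Real.log ρ)) + x * Real.log D + ρ ^ 5 / D - x := by
    intro x ρ hx hρ h
    have := negMulLog_le_gibbs (q := ρ ^ 5 / D) hx (by positivity) (fun hx h0 => hx (h (by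
      have := (div_eq_zero_iff.1 h0).resolve_right hD0.ne'
      simpa using this)))
    rcases hρ.eq_or_lt with rfl | hρ
    · rw [h rfl]; simp
    · rw [Real.log_div (by positivity) hD0.ne', Real.log_pow] at this
      push_cast at this
      linarith
  have g1 := gibbs a σ ha hσ (fun h => by rw [haσ, h]; simp)
  have g2 := gibbs b τ hb hτ (fun h => by rw [hbτ, h]; simp)
  have g3 := gibbs c 1 hc zero_le_one (by norm_num)
  have hsum : σ ^ 5 / D + τ ^ 5 / D + 1 ^ 5 / D = 1 := by
    rw [← add_div, ← add_div, div_eq_one_iff_eq hD0.ne', hD]; ring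
  have hlog : a * Real.log D + b * Real.log D + c * Real.log D = Real.log D := by
    linear_combination Real.log D * habc
  rw [log_pairWeight hσ hτ, ← hD, blockExponent, habc, Real.negMulLog_one]
  rw [Real.log_one] at g3
  linarith

theorem one_lt_pairWeight {s t : ℝ} (hs : 57 / 100 ≤ s) (hs' : s ≤ 58 / 100)
    (hst : branchMap s = t) (hts : branchMap t = s) : 1 < pairWeight s t := by
  -- The test point (1, 0) has weight 2.
  refine lt_of_lt_of_le ?_ (pairWeight_le hs hs' hst hts zero_le_one le_rfl).1
  norm_num [pairWeight]

theorem blockExponent_le_of_add_eq_one {s t : ℝ} (hs : 57 / 100 ≤ s) (hs' : s ≤ 58 / 100)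
    (hst : branchMap s = t) (hts : branchMap t = s) {a b c : ℝ} (ha : 0 ≤ a) (hb : 0 ≤ b)
    (hc : 0 ≤ c) (habc : a + b + c = 1) :
    blockExponent a b c ≤ Real.log (pairWeight s t) ∧
      (blockExponent a b c = Real.log (pairWeight s t) →
        a = s ^ 6 / (1 + s ^ 6) ∧ b = t ^ 6 / (1 + t ^ 6) ∨
          a = t ^ 6 / (1 + t ^ 6) ∧ b = s ^ 6 / (1 + s ^ 6)) := by
  -- Positivity handles the degenerate blocks a = 1 and b = 1, where the odds are infinite and the
  -- exponent is 0.
  have hK := Real.log_pos (one_lt_pairWeight hs hs' hst hts)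
  rcases (add_nonneg hb hc).eq_or_lt with hbc | hbc
  · have hb0 : b = 0 := by linarith
    have hc0 : c = 0 := by linarith
    have ha1 : a = 1 := by linarith
    have : blockExponent a b c = 0 := by simp [blockExponent, hb0, hc0, ha1]
    rw [this]
    exact ⟨hK.le, fun h => absurd h hK.ne⟩
  rcases (add_nonneg ha hc).eq_or_lt with hac | hac
  · have ha0 : a = 0 := by linarith
    have hc0 : c = 0 := by linarith
    have hb1 : b = 1 := by linarith
    have : blockExponent a b c = 0 := by simp [blockExponent, ha0, hc0, hb1]
    rw [this]
    exact ⟨hK.le, fun h => absurd h hK.ne⟩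
  obtain ⟨σ, hσ, hσ6⟩ := exists_pow_six_eq (div_nonneg ha hbc.le)
  obtain ⟨τ, hτ, hτ6⟩ := exists_pow_six_eq (div_nonneg hb hac.le)
  have haσ : a = σ ^ 6 * (b + c) := by rw [hσ6]; field_simp
  have hbτ : b = τ ^ 6 * (a + c) := by rw [hτ6]; field_simp
  have h1 := blockExponent_le_log_pairWeight ha hb hc habc hbc hac hσ hτ haσ hbτ
  obtain ⟨h2, h3⟩ := pairWeight_le hs hs' hst hts hσ hτ
  have hpos : 0 < pairWeight σ τ := by unfold pairWeight; positivity
  have hKpos := hpos.trans_le h2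
  have h4 := Real.log_le_log hpos h2
  refine ⟨h1.trans h4, fun h => ?_⟩
  have ea : a = σ ^ 6 / (1 + σ ^ 6) := by
    rw [eq_div_iff (by positivity)]
    linear_combination haσ + σ ^ 6 * habc
  have eb : b = τ ^ 6 / (1 + τ ^ 6) := by
    rw [eq_div_iff (by positivity)]
    linear_combination hbτ + τ ^ 6 * habc
  rcases h3 (Real.log_injOn_pos hpos hKpos (le_antisymm h4 (h ▸ h1))) with ⟨rfl, rfl⟩ | ⟨rfl, rfl⟩
  · exact Or.inl ⟨ea, eb⟩
  · exact Or.inr ⟨ea, eb⟩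

theorem blockExponent_le {s t : ℝ} (hs : 57 / 100 ≤ s) (hs' : s ≤ 58 / 100)
    (hst : branchMap s = t) (hts : branchMap t = s) {a b c T : ℝ} (ha : 0 ≤ a) (hb : 0 ≤ b)
    (hc : 0 ≤ c) (hT : 0 < T) (habc : a + b + c = T) :
    blockExponent a b c ≤ T * Real.log (pairWeight s t) ∧
      (blockExponent a b c = T * Real.log (pairWeight s t) →
        a = T * (s ^ 6 / (1 + s ^ 6)) ∧ b = T * (t ^ 6 / (1 + t ^ 6)) ∨
          a = T * (t ^ 6 / (1 + t ^ 6)) ∧ b = T * (s ^ 6 / (1 + s ^ 6))) := by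
  obtain ⟨h1, h2⟩ := blockExponent_le_of_add_eq_one hs hs' hst hts (div_nonneg ha hT.le)
    (div_nonneg hb hT.le) (div_nonneg hc hT.le) (by rw [← add_div, ← add_div, habc, div_self hT.ne'])
  have e : blockExponent a b c = T * blockExponent (a / T) (b / T) (c / T) := by
    rw [← blockExponent_mul, mul_div_cancel₀ _ hT.ne', mul_div_cancel₀ _ hT.ne',
      mul_div_cancel₀ _ hT.ne']
  rw [e]
  refine ⟨mul_le_mul_of_nonneg_left h1 hT.le, fun h => ?_⟩
  have := h2 (mul_left_cancel₀ hT.ne' h)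
  simpa only [div_eq_iff hT.ne', mul_comm T] using this

/-- The two-cycle equations make the densities equal to the Gibbs reference (s⁵, t⁵, 1)/D, so the
Gibbs bound is an equality. -/
theorem blockExponent_extremal {s t : ℝ} (hs : 0 < s) (ht : 0 < t)
    (hst : branchMap s = t) (hts : branchMap t = s) :
    0 < 1 - s ^ 6 / (1 + s ^ 6) - t ^ 6 / (1 + t ^ 6) ∧
    blockExponent (s ^ 6 / (1 + s ^ 6)) (t ^ 6 / (1 + t ^ 6))
      (1 - s ^ 6 / (1 + s ^ 6) - t ^ 6 / (1 + t ^ 6)) = Real.log (pairWeight s t) := by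
  unfold branchMap at hst hts
  rw [div_eq_iff (by positivity)] at hst hts
  obtain ⟨D, hD⟩ : ∃ D, D = 1 + s ^ 5 + t ^ 5 := ⟨_, rfl⟩
  have hD0 : 0 < D := by rw [hD]; positivity
  obtain ⟨a, hA⟩ : ∃ a, a = s ^ 6 / (1 + s ^ 6) := ⟨_, rfl⟩
  obtain ⟨b, hB⟩ : ∃ b, b = t ^ 6 / (1 + t ^ 6) := ⟨_, rfl⟩
  have ha : a = s ^ 5 / D := by
    rw [hA, div_eq_div_iff (by positivity) hD0.ne', hD]
    linear_combination (-s ^ 5) * hts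
  have hb : b = t ^ 5 / D := by
    rw [hB, div_eq_div_iff (by positivity) hD0.ne', hD]
    linear_combination (-t ^ 5) * hst
  have hc : 1 - a - b = 1 / D := by
    rw [ha, hb]; field_simp; rw [hD]; ring
  have ham : a = s ^ 6 * (1 - a) := by rw [hA]; field_simp; ring
  have hbm : b = t ^ 6 * (1 - b) := by rw [hB]; field_simp; ring
  have ha1 : 0 < 1 - a := by
    have : 0 < 1 / D + b := by rw [hb]; positivity
    linarith
  have hb1 : 0 < 1 - b := by
    have : 0 < 1 / D + a := by rw [ha]; positivity
    linarith
  have h1 := negMulLog_add_negMulLog_odds hs.le ha1 (by ring) ham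
  have h2 := negMulLog_add_negMulLog_odds ht.le hb1 (by ring) hbm
  rw [← hA, ← hB]
  refine ⟨by rw [hc]; positivity, ?_⟩
  have la : Real.negMulLog a = -(a * (5 * Real.log s - Real.log D)) := by
    rw [Real.negMulLog]
    nth_rewrite 2 [ha]
    rw [Real.log_div (by positivity) hD0.ne', Real.log_pow]
    push_cast
    ring
  have lb : Real.negMulLog b = -(b * (5 * Real.log t - Real.log D)) := by
    rw [Real.negMulLog]
    nth_rewrite 2 [hb]
    rw [Real.log_div (by positivity) hD0.ne', Real.log_pow]
    push_cast
    ring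
  have lc : Real.negMulLog (1 - a - b) = (1 - a - b) * Real.log D := by
    rw [Real.negMulLog]
    nth_rewrite 2 [hc]
    rw [Real.log_div one_ne_zero hD0.ne', Real.log_one]
    ring
  rw [log_pairWeight hs.le ht.le, ← hD, blockExponent, show b + (1 - a - b) = 1 - a by ring,
    show a + (1 - a - b) = 1 - b by ring, show a + b + (1 - a - b) = 1 by ring,
    Real.negMulLog_one]
  linear_combination 6 * la + 6 * lb + 6 * lc - 5 * h1 - 5 * h2

/-! ### The second moment exponent as a sum of entropies -/

theorem entropyH₁_eq (x y : ℝ) :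
    entropyH₁ x y = Real.negMulLog x + Real.negMulLog (y - x) - Real.negMulLog y := by
  simp only [entropyH₁, Real.negMulLog]
  ring

theorem secondMomentExponent_eq (α β γ δ ε : ℝ) :
    secondMomentExponent 6 1 α β γ δ ε =
      Real.negMulLog γ - 4 * Real.negMulLog (α - γ) - 5 * Real.negMulLog (1 - 2 * α + γ)
      + Real.negMulLog δ - 4 * Real.negMulLog (β - δ) - 5 * Real.negMulLog (1 - 2 * β + δ)
      + 6 * (Real.negMulLog ε + Real.negMulLog (1 - 2 * β + δ - γ - ε)
        + Real.negMulLog (α - γ - ε) + Real.negMulLog (β - δ - (α - γ - ε))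
        + Real.negMulLog (1 - α - β - ε) - Real.negMulLog (1 - β - γ - ε)) := by
  simp only [secondMomentExponent, entropyH, entropyH₁_eq, Real.log_one, Real.negMulLog_one]
  rw [show 1 - α - (α - γ) = 1 - 2 * α + γ by ring, show 1 - β - (β - δ) = 1 - 2 * β + δ by ring,
    show 1 - γ - (α - γ) = 1 - α by ring,
    show 1 - β - γ - ε - (α - γ) = 1 - α - β - ε by ring]
  push_cast
  ring

/-- Both sides are the entropy of a `2 × 2` table with independent rows and columns. -/
theorem negMulLog_table {n m P Q T : ℝ} (hT : 0 < T) (h1 : n + m = T) (h2 : P + Q = T) :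
    Real.negMulLog (n * P / T) + Real.negMulLog (n * Q / T) + Real.negMulLog (m * P / T)
      + Real.negMulLog (m * Q / T) =
    Real.negMulLog n + Real.negMulLog m + Real.negMulLog P + Real.negMulLog Q
      - Real.negMulLog T := by
  obtain ⟨x, rfl⟩ : ∃ x, n = T * x := ⟨n / T, by field_simp⟩
  obtain ⟨y, rfl⟩ : ∃ y, P = T * y := ⟨P / T, by field_simp⟩
  obtain rfl : m = T * (1 - x) := by linarith
  obtain rfl : Q = T * (1 - y) := by linarith
  have e : ∀ u v : ℝ, T * u * (T * v) / T = T * (u * v) := fun u v => by field_simp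
  simp only [e, Real.negMulLog_mul]
  ring

/-- The log-sum inequality. -/
theorem negMulLog_superadditive {a b a' b' : ℝ} (ha : 0 ≤ a) (hb : 0 ≤ b) (ha' : 0 ≤ a')
    (hb' : 0 ≤ b') :
    Real.negMulLog a + Real.negMulLog b - Real.negMulLog (a + b)
      + (Real.negMulLog a' + Real.negMulLog b' - Real.negMulLog (a' + b')) ≤
    Real.negMulLog (a + a') + Real.negMulLog (b + b') - Real.negMulLog (a + a' + (b + b')) := by
  rcases (add_nonneg (add_nonneg ha ha') (add_nonneg hb hb')).eq_or_lt with h0 | hS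
  · have h1 : a = 0 := by linarith
    have h2 : a' = 0 := by linarith
    have h3 : b = 0 := by linarith
    have h4 : b' = 0 := by linarith
    simp [h1, h2, h3, h4]
  obtain ⟨S, hSd⟩ : ∃ S, S = a + a' + (b + b') := ⟨_, rfl⟩
  rw [← hSd] at hS ⊢
  have key : ∀ x t A : ℝ, 0 ≤ x → x ≤ t → x ≤ A →
      Real.negMulLog x ≤ -(x * (Real.log t + Real.log A - Real.log S)) + t * A / S - x := by
    intro x t A hx ht hA
    rcases hx.eq_or_lt with rfl | hx
    · simp only [Real.negMulLog_zero, zero_mul, neg_zero, zero_add, sub_zero]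
      positivity
    · have ht' := hx.trans_le ht
      have hA' := hx.trans_le hA
      have := negMulLog_le_gibbs (q := t * A / S) hx.le (by positivity) (fun _ => by positivity)
      rwa [Real.log_div (by positivity) hS.ne', Real.log_mul ht'.ne' hA'.ne'] at this
  have k1 := key a (a + b) (a + a') ha (by linarith) (by linarith)
  have k2 := key b (a + b) (b + b') hb (by linarith) (by linarith)
  have k3 := key a' (a' + b') (a + a') ha' (by linarith) (by linarith)
  have k4 := key b' (a' + b') (b + b') hb' (by linarith) (by linarith)
  have hsum : (a + b) * (a + a') / S + (a + b) * (b + b') / S + (a' + b') * (a + a') / S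
      + (a' + b') * (b + b') / S = a + b + a' + b' := by
    field_simp
    rw [hSd]
    ring
  simp only [Real.negMulLog] at *
  have : S * Real.log S = (a + a' + (b + b')) * Real.log S := by rw [← hSd]
  linarith

/-- The number of edges from left vertices occupied only in the second configuration to right
vertices unoccupied in both. -/
noncomputable def freeEdges (α β γ δ ε : ℝ) : ℝ :=
  (α - γ) * (1 - 2 * β + δ - γ - ε) / (1 - β - γ - ε)

/-- Admissibility, in terms of the blocks of edges with a given type in the first configuration. -/
theorem freeEdges_bounds {α β γ δ ε : ℝ} (h : (γ, δ, ε) ∈ admissibleRegion α β)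
    (hT : 0 < 1 - β - γ - ε) :
    0 ≤ freeEdges α β γ δ ε ∧ freeEdges α β γ δ ε ≤ α - γ ∧
      freeEdges α β γ δ ε ≤ 1 - 2 * β + δ - γ - ε ∧
      0 ≤ β - δ - (α - γ) + freeEdges α β γ δ ε := by
  obtain ⟨⟨h1, h2, h3⟩, ⟨h4, h5, h6⟩, h7, h8⟩ := h
  simp only at h1 h2 h3 h4 h5 h6 h7 h8
  have hn : 0 ≤ α - γ := by linarith
  have e1 : α - γ - freeEdges α β γ δ ε = (α - γ) * (β - δ) / (1 - β - γ - ε) := by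
    unfold freeEdges; field_simp; ring
  have e2 : 1 - 2 * β + δ - γ - ε - freeEdges α β γ δ ε =
      (1 - α - β - ε) * (1 - 2 * β + δ - γ - ε) / (1 - β - γ - ε) := by
    unfold freeEdges; field_simp; ring
  have e3 : β - δ - (α - γ) + freeEdges α β γ δ ε =
      (1 - α - β - ε) * (β - δ) / (1 - β - γ - ε) := by
    unfold freeEdges; field_simp; ring
  have p0 : 0 ≤ freeEdges α β γ δ ε := div_nonneg (mul_nonneg hn h3) hT.le
  have p1 := div_nonneg (mul_nonneg hn h2) hT.le
  have p2 := div_nonneg (mul_nonneg h8 h3) hT.le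
  have p3 := div_nonneg (mul_nonneg h8 h2) hT.le
  rw [← e1] at p1
  rw [← e2] at p2
  rw [← e3] at p3
  exact ⟨p0, by linarith, by linarith, p3⟩

/-- Conditioning on the edge types of the first configuration. -/
theorem secondMomentExponent_le_blocks {α β γ δ ε : ℝ} (h : (γ, δ, ε) ∈ admissibleRegion α β)
    (hT : 0 < 1 - β - γ - ε) {k : ℝ} (hk : k = freeEdges α β γ δ ε) :
    secondMomentExponent 6 1 α β γ δ ε ≤ blockExponent α β (1 - α - β)
      + blockExponent γ (α - γ - ε) ε
      + blockExponent (α - γ - k) δ (β - δ - (α - γ) + k)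
      + blockExponent k (β - δ - (α - γ - ε)) (1 - 2 * β + δ - γ - ε - k) := by
  obtain ⟨k1, k2, k3, k4⟩ := freeEdges_bounds h hT
  rw [← hk] at k1 k2 k3 k4
  obtain ⟨⟨h1, h2, h3⟩, ⟨h4, h5, h6⟩, h7, h8⟩ := h
  simp only at h1 h2 h3 h4 h5 h6 h7 h8
  -- The table concerns edges whose left end is unoccupied in the first configuration and whose
  -- right end is unoccupied in the second. The choice of k makes the left end's second state
  -- independent of the right end's first state.
  have table := negMulLog_table (n := α - γ) (m := 1 - α - β - ε) (P := 1 - 2 * β + δ - γ - ε)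
    (Q := β - δ) hT (by ring) (by ring)
  rw [show (α - γ) * (1 - 2 * β + δ - γ - ε) / (1 - β - γ - ε) = k from hk.symm,
    show (α - γ) * (β - δ) / (1 - β - γ - ε) = α - γ - k by
      rw [hk]; unfold freeEdges; field_simp; ring,
    show (1 - α - β - ε) * (1 - 2 * β + δ - γ - ε) / (1 - β - γ - ε) =
        1 - 2 * β + δ - γ - ε - k by
      rw [hk]; unfold freeEdges; field_simp; ring,
    show (1 - α - β - ε) * (β - δ) / (1 - β - γ - ε) = β - δ - (α - γ) + k by
      rw [hk]; unfold freeEdges; field_simp; ring] at table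
  -- Forgetting the other end of the edge increases conditional entropy: `sa` for left vertices,
  -- `sb` for right ones. Each enters the final estimate with factor 5 = d - 1, and the table
  -- identity with factor 6 = d.
  have sa := negMulLog_superadditive (a := α - γ - k) (b := δ + (β - δ - (α - γ) + k)) (a' := k)
    (b' := β - δ - (α - γ - ε) + (1 - 2 * β + δ - γ - ε - k)) (by linarith) (by linarith) k1
    (by linarith)
  have sb := negMulLog_superadditive (a := α - γ - ε) (b := γ + ε) (a' := β - δ - (α - γ - ε))
    (b' := 1 - 2 * β + δ - γ - ε) h1 (by linarith) h7 h3
  rw [show α - γ - k + k = α - γ by ring,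
    show α - γ - k + (δ + (β - δ - (α - γ) + k)) = β by ring,
    show k + (β - δ - (α - γ - ε) + (1 - 2 * β + δ - γ - ε - k)) = 1 - α - β by ring,
    show δ + (β - δ - (α - γ) + k) + (β - δ - (α - γ - ε) + (1 - 2 * β + δ - γ - ε - k)) =
      1 - 2 * α + γ by ring, show α - γ + (1 - 2 * α + γ) = 1 - α by ring] at sa
  rw [show α - γ - ε + (β - δ - (α - γ - ε)) = β - δ by ring,
    show α - γ - ε + (γ + ε) = α by ring,
    show β - δ - (α - γ - ε) + (1 - 2 * β + δ - γ - ε) = 1 - α - β by ring,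
    show γ + ε + (1 - 2 * β + δ - γ - ε) = 1 - 2 * β + δ by ring,
    show β - δ + (1 - 2 * β + δ) = 1 - β by ring] at sb
  rw [secondMomentExponent_eq]
  unfold blockExponent
  rw [show β + (1 - α - β) = 1 - α by ring, show α + (1 - α - β) = 1 - β by ring,
    show α + β + (1 - α - β) = 1 by ring, Real.negMulLog_one,
    show α - γ - ε + ε = α - γ by ring, show γ + (α - γ - ε) + ε = α by ring,
    show α - γ - k + (β - δ - (α - γ) + k) = β - δ by ring,
    show α - γ - k + δ + (β - δ - (α - γ) + k) = β by ring,
    show k + (1 - 2 * β + δ - γ - ε - k) = 1 - 2 * β + δ - γ - ε by ring,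
    show k + (β - δ - (α - γ - ε)) + (1 - 2 * β + δ - γ - ε - k) = 1 - α - β by ring]
  linarith

/-- Every entropy argument factors into single densities, as for two independent configurations, and
`negMulLog` of a product splits. -/
theorem secondMomentExponent_product (α β : ℝ) :
    secondMomentExponent 6 1 α β (α ^ 2) (β ^ 2) (α * (1 - α - β)) =
      2 * blockExponent α β (1 - α - β) := by
  rw [secondMomentExponent_eq]
  unfold blockExponent
  rw [show β + (1 - α - β) = 1 - α by ring, show α + (1 - α - β) = 1 - β by ring,
    show α + β + (1 - α - β) = 1 by ring, Real.negMulLog_one,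
    show α ^ 2 = α * α by ring, show β ^ 2 = β * β by ring,
    show α - α * α = α * (1 - α) by ring, show β - β * β = β * (1 - β) by ring,
    show 1 - 2 * α + α * α = (1 - α) * (1 - α) by ring,
    show 1 - 2 * β + β * β - α * α - α * (1 - α - β) = (1 - β) * (1 - α - β) by ring,
    show 1 - 2 * β + β * β = (1 - β) * (1 - β) by ring,
    show α * (1 - α) - α * (1 - α - β) = α * β by ring,
    show β * (1 - β) - α * β = β * (1 - α - β) by ring,
    show 1 - α - β - α * (1 - α - β) = (1 - α) * (1 - α - β) by ring,
    show 1 - β - α * α - α * (1 - α - β) = (1 - α) * (1 - β) by ring]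
  simp only [Real.negMulLog_mul]
  ring

theorem product_mem_admissibleRegion {α β : ℝ} (hα : 0 ≤ α) (hβ : 0 ≤ β) (h : 0 ≤ 1 - α - β) :
    (α ^ 2, β ^ 2, α * (1 - α - β)) ∈ admissibleRegion α β := by
  have e1 := mul_nonneg hα hβ
  have e2 := mul_nonneg hβ h
  have e3 := mul_nonneg hα h
  have e4 := mul_nonneg (by linarith : 0 ≤ 1 - β) h
  have e5 := mul_nonneg (by linarith : 0 ≤ 1 - α) h
  have e6 := mul_nonneg hβ (by linarith : 0 ≤ 1 - β)
  refine ⟨⟨?_, ?_, ?_⟩, ⟨?_, ?_, ?_⟩, ?_, ?_⟩ <;> simp only <;> nlinarith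

/-- The values of the densities, to the precision needed below. -/
theorem density_bounds {s t : ℝ} (hs : 57 / 100 ≤ s) (hs' : s ≤ 58 / 100)
    (hst : branchMap s = t) :
    3 / 100 < s ^ 6 / (1 + s ^ 6) ∧ s ^ 6 / (1 + s ^ 6) < 4 / 100 ∧
      40 / 100 < t ^ 6 / (1 + t ^ 6) ∧ t ^ 6 / (1 + t ^ 6) < 42 / 100 := by
  have hs0 : 0 ≤ s := by linarith
  have ht : 937 / 1000 ≤ t := by
    rw [← hst]
    exact le_trans (by norm_num [branchMap]) (branchMap_anti hs0 hs')
  have ht' : t ≤ 944 / 1000 := by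
    rw [← hst]
    exact (branchMap_anti (by norm_num) hs).trans (by norm_num [branchMap])
  have a1 := pow_le_pow_left₀ (by norm_num) hs 6
  have a2 := pow_le_pow_left₀ hs0 hs' 6
  have b1 := pow_le_pow_left₀ (by norm_num) ht 6
  have b2 := pow_le_pow_left₀ (by linarith) ht' 6
  norm_num at a1 a2 b1 b2
  refine ⟨?_, ?_, ?_, ?_⟩
  · rw [lt_div_iff₀ (by positivity)]; linarith
  · rw [div_lt_iff₀ (by positivity)]; linarith
  · rw [lt_div_iff₀ (by positivity)]; linarith
  · rw [div_lt_iff₀ (by positivity)]; linarith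

/-- At the extremal densities the product point is the only maximum. -/
theorem eq_product_of_le {s t : ℝ} (hs : 57 / 100 ≤ s) (hs' : s ≤ 58 / 100)
    (hst : branchMap s = t) (hts : branchMap t = s) {α β γ δ ε : ℝ}
    (hα : α = s ^ 6 / (1 + s ^ 6)) (hβ : β = t ^ 6 / (1 + t ^ 6))
    (h : (γ, δ, ε) ∈ admissibleRegion α β)
    (hle : secondMomentExponent 6 1 α β (α ^ 2) (β ^ 2) (α * (1 - α - β)) ≤
      secondMomentExponent 6 1 α β γ δ ε) :
    γ = α ^ 2 ∧ δ = β ^ 2 ∧ ε = α * (1 - α - β) := by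
  obtain ⟨a1, a2, b1, b2⟩ := density_bounds hs hs' hst
  have ht0 : 0 < t := hst ▸ branchMap_pos (by linarith)
  obtain ⟨hc, hΦ⟩ := blockExponent_extremal (by linarith) ht0 hst hts
  rw [← hα] at a1 a2
  rw [← hβ] at b1 b2
  rw [← hα, ← hβ] at hc hΦ
  rw [secondMomentExponent_product, hΦ] at hle
  have hT : 0 < 1 - β - γ - ε := by
    have := h.1.1
    simp only at this
    linarith
  obtain ⟨k, hk⟩ : ∃ k, k = freeEdges α β γ δ ε := ⟨_, rfl⟩
  have hle' := secondMomentExponent_le_blocks h hT hk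
  rw [hΦ] at hle'
  obtain ⟨k1, k2, k3, k4⟩ := freeEdges_bounds h hT
  rw [← hk] at k1 k2 k3 k4
  obtain ⟨⟨h1, h2, h3⟩, ⟨h4, h5, h6⟩, h7, h8⟩ := h
  simp only at h1 h2 h3 h4 h5 h6 h7 h8
  obtain ⟨u1, v1⟩ := blockExponent_le hs hs' hst hts h4 h1 h6 (show 0 < α by linarith)
    (show γ + (α - γ - ε) + ε = α by ring)
  obtain ⟨u2, v2⟩ := blockExponent_le hs hs' hst hts (show 0 ≤ α - γ - k by linarith) h5 k4
    (show 0 < β by linarith) (show α - γ - k + δ + (β - δ - (α - γ) + k) = β by ring)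
  obtain ⟨u3, v3⟩ := blockExponent_le hs hs' hst hts k1 h7
    (show 0 ≤ 1 - 2 * β + δ - γ - ε - k by linarith) hc
    (show k + (β - δ - (α - γ - ε)) + (1 - 2 * β + δ - γ - ε - k) = 1 - α - β by ring)
  rw [← hα, ← hβ] at v1 v2 v3
  -- The second configuration's left densities in the three blocks add up to α. Any reversed block
  -- would push this sum strictly above α.
  have m1 : α * α < α * β := mul_lt_mul_of_pos_left (by linarith) (by linarith)
  have m2 : β * α < β * β := mul_lt_mul_of_pos_left (by linarith) (by linarith)
  have m3 : (1 - α - β) * α < (1 - α - β) * β := mul_lt_mul_of_pos_left (by linarith) hc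
  have hsum : α * α + β * α + (1 - α - β) * α = α := by ring
  have w1 := v1 (by linarith)
  have w2 := v2 (by linarith)
  have w3 := v3 (by linarith)
  rcases w1 with w1 | w1 <;> rcases w2 with w2 | w2 <;> rcases w3 with w3 | w3
  case inl.inl.inl =>
    refine ⟨by rw [w1.1, sq], by rw [w2.2, sq], ?_⟩
    linarith [w1.1, w1.2]
  all_goals exfalso; linarith [w1.1, w2.1, w3.1]

/-! ### Concavity near the extremal densities -/

/-- The sign condition says that G does not decrease towards x from either side. -/
theorem le_of_deriv_mul_sub_nonpos {S : Set ℝ} (hS : S.OrdConnected) {G G' : ℝ → ℝ} {x y : ℝ}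
    (hx : x ∈ S) (hy : y ∈ S) (hG : ∀ z ∈ S, HasDerivAt G (G' z) z)
    (hsign : ∀ z ∈ S, G' z * (z - x) ≤ 0) : G y ≤ G x := by
  rcases lt_trichotomy x y with h | rfl | h
  · have hsub : Set.Icc x y ⊆ S := hS.out hx hy
    obtain ⟨z, hz, e⟩ := exists_hasDerivAt_eq_slope G G' h
      (fun w hw => (hG w (hsub hw)).continuousAt.continuousWithinAt)
      (fun w hw => hG w (hsub (Set.Ioo_subset_Icc_self hw)))
    have h1 := hsign z (hsub (Set.Ioo_subset_Icc_self hz))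
    have h2 : G' z ≤ 0 := nonpos_of_mul_nonpos_left h1 (sub_pos.2 hz.1)
    rw [e, div_nonpos_iff] at h2
    rcases h2 with h2 | h2 <;> linarith
  · exact le_rfl
  · have hsub : Set.Icc y x ⊆ S := hS.out hy hx
    obtain ⟨z, hz, e⟩ := exists_hasDerivAt_eq_slope G G' h
      (fun w hw => (hG w (hsub hw)).continuousAt.continuousWithinAt)
      (fun w hw => hG w (hsub (Set.Ioo_subset_Icc_self hw)))
    have h1 := hsign z (hsub (Set.Ioo_subset_Icc_self hz))
    have h2 : 0 ≤ G' z := by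
      by_contra! hneg
      have := mul_pos_of_neg_of_neg hneg (sub_neg.2 hz.2)
      linarith
    rw [e, div_nonneg_iff] at h2
    rcases h2 with h2 | h2 <;> linarith

/-- The second derivative -1/z of `negMulLog` is at most -1/C for z ≤ C and at least -1/C for z ≥ C.
Comparing with the parabola of curvature -1/C thus gives an upper or a lower Taylor bound. -/
theorem hasDerivAt_negMulLog_remainder {x z : ℝ} (C : ℝ) (hz : 0 < z) :
    HasDerivAt (fun z => Real.negMulLog z + (Real.log x + 1) * (z - x) + (z - x) ^ 2 / (2 * C))
      (Real.log x - Real.log z + (z - x) / C) z := by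
  have h1 := (hasDerivAt_id z).sub_const x
  have h := ((Real.hasDerivAt_negMulLog hz.ne').add (h1.const_mul (Real.log x + 1))).add
    ((h1.pow 2).div_const (2 * C))
  refine h.congr_deriv ?_
  simp only [id]
  rcases eq_or_ne C 0 with rfl | hC
  · simp
    ring
  · field_simp
    push_cast
    ring

theorem log_sub_log_mul_le {x z : ℝ} (hx : 0 < x) (hz : 0 < z) :
    (Real.log x - Real.log z) * (z - x) ≤ -((z - x) ^ 2 / max x z) ∧
      -((z - x) ^ 2 / min x z) ≤ (Real.log x - Real.log z) * (z - x) := by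
  have h1 := Real.log_le_sub_one_of_pos (div_pos hx hz)
  have h2 := Real.log_le_sub_one_of_pos (div_pos hz hx)
  rw [Real.log_div hx.ne' hz.ne'] at h1
  rw [Real.log_div hz.ne' hx.ne'] at h2
  have e1 : (x / z - 1) * (z - x) = -((z - x) ^ 2 / z) := by field_simp; ring
  have e2 : (z / x - 1) * (z - x) = (z - x) ^ 2 / x := by field_simp
  rcases le_total x z with h | h
  · rw [max_eq_right h, min_eq_left h]
    have f1 := mul_le_mul_of_nonneg_right h1 (sub_nonneg.2 h)
    have f2 := mul_le_mul_of_nonneg_right h2 (sub_nonneg.2 h)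
    rw [e1] at f1
    rw [e2] at f2
    exact ⟨f1, by linarith⟩
  · rw [max_eq_left h, min_eq_right h]
    have f1 := mul_le_mul_of_nonpos_right h1 (sub_nonpos.2 h)
    have f2 := mul_le_mul_of_nonpos_right h2 (sub_nonpos.2 h)
    rw [e1] at f1
    rw [e2] at f2
    exact ⟨by linarith, f1⟩

theorem negMulLog_le_taylor {x y C : ℝ} (hx : 0 < x) (hy : 0 < y) (hxC : x ≤ C) (hyC : y ≤ C) :
    Real.negMulLog y ≤ Real.negMulLog x - (Real.log x + 1) * (y - x) - (y - x) ^ 2 / (2 * C) := by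
  have := le_of_deriv_mul_sub_nonpos (S := Set.Ioc 0 C) Set.ordConnected_Ioc ⟨hx, hxC⟩ ⟨hy, hyC⟩
    (fun z hz => hasDerivAt_negMulLog_remainder (x := x) C hz.1) (fun z hz => by
      have h1 := (log_sub_log_mul_le hx hz.1).1
      have h2 : (z - x) ^ 2 / C ≤ (z - x) ^ 2 / max x z :=
        div_le_div_of_nonneg_left (sq_nonneg _) (lt_max_of_lt_left hx) (max_le hxC hz.2)
      have h3 : (z - x) / C * (z - x) = (z - x) ^ 2 / C := by ring
      rw [add_mul, h3]
      linarith)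
  simp only [sub_self, mul_zero] at this
  norm_num at this
  linarith

theorem taylor_le_negMulLog {x y m : ℝ} (hm : 0 < m) (hx : m ≤ x) (hy : m ≤ y) :
    Real.negMulLog x - (Real.log x + 1) * (y - x) - (y - x) ^ 2 / (2 * m) ≤ Real.negMulLog y := by
  have := le_of_deriv_mul_sub_nonpos (S := Set.Ici m) Set.ordConnected_Ici hx hy
    (fun z hz => (hasDerivAt_negMulLog_remainder (x := x) m (hm.trans_le hz)).neg) (fun z hz => by
      have hz' : m ≤ z := hz
      have h1 := (log_sub_log_mul_le (hm.trans_le hx) (hm.trans_le hz')).2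
      have h2 : (z - x) ^ 2 / min x z ≤ (z - x) ^ 2 / m :=
        div_le_div_of_nonneg_left (sq_nonneg _) hm (le_min hx hz)
      have h3 : (z - x) / m * (z - x) = (z - x) ^ 2 / m := by ring
      rw [neg_mul, add_mul, h3]
      linarith)
  simp only [Pi.neg_apply, sub_self, mul_zero] at this
  norm_num at this
  linarith

/-- The range of the densities near the extremal ones. -/
def InDensityBox (a b : ℝ) : Prop :=
  3 / 100 < a ∧ a < 4 / 100 ∧ 40 / 100 < b ∧ b < 42 / 100

/-- The denominators are the box's upper bounds for a, b, 1 - a - b, whose entropies count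
positively, and its lower bounds for 1 - a, 1 - b, whose entropies count negatively. -/
theorem densityBox_quadratic (x y : ℝ) :
    (x ^ 2 + y ^ 2) / 10 ≤ x ^ 2 / (2 * (4 / 100)) + y ^ 2 / (2 * (42 / 100))
      + 6 * ((x + y) ^ 2 / (2 * (57 / 100))) - 5 * (x ^ 2 / (2 * (96 / 100)))
      - 5 * (y ^ 2 / (2 * (58 / 100))) := by
  have e : x ^ 2 / (2 * (4 / 100)) + y ^ 2 / (2 * (42 / 100))
      + 6 * ((x + y) ^ 2 / (2 * (57 / 100))) - 5 * (x ^ 2 / (2 * (96 / 100)))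
      - 5 * (y ^ 2 / (2 * (58 / 100))) - (x ^ 2 + y ^ 2) / 10 =
      25 / 114 * (8 * x + 3 * y) ^ 2
      + (25 / 2 + 100 / 19 - 125 / 48 - 1 / 10 - 1600 / 114) * x ^ 2
      + (25 / 21 + 100 / 19 - 125 / 29 - 1 / 10 - 225 / 114) * y ^ 2 := by ring
  rw [← sub_nonneg, e]
  norm_num
  positivity

theorem eq_zero_of_mul_sq_add_sq_nonpos {T x y : ℝ} (hT : 0 < T)
    (h : T * ((x ^ 2 + y ^ 2) / 10) ≤ 0) : x = 0 ∧ y = 0 := by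
  have h1 := nonpos_of_mul_nonpos_right h hT
  have hx := sq_nonneg x
  have hy := sq_nonneg y
  exact ⟨pow_eq_zero_iff two_ne_zero |>.1 (by linarith), pow_eq_zero_iff two_ne_zero |>.1 (by linarith)⟩

theorem blockExponent_le_tangent {α β : ℝ} (h : InDensityBox α β) : ∃ p r : ℝ, ∀ a b : ℝ,
    InDensityBox a b → blockExponent a b (1 - a - b) ≤ blockExponent α β (1 - α - β)
      + p * (a - α) + r * (b - β) - ((a - α) ^ 2 + (b - β) ^ 2) / 10 := by
  obtain ⟨h1, h2, h3, h4⟩ := h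
  refine ⟨-(Real.log α + 1) + 6 * (Real.log (1 - α - β) + 1) - 5 * (Real.log (1 - α) + 1),
    -(Real.log β + 1) + 6 * (Real.log (1 - α - β) + 1) - 5 * (Real.log (1 - β) + 1), ?_⟩
  rintro a b ⟨g1, g2, g3, g4⟩
  have ta := negMulLog_le_taylor (x := α) (y := a) (C := 4 / 100) (by linarith) (by linarith)
    h2.le g2.le
  have tb := negMulLog_le_taylor (x := β) (y := b) (C := 42 / 100) (by linarith) (by linarith)
    h4.le g4.le
  have tc := negMulLog_le_taylor (x := 1 - α - β) (y := 1 - a - b) (C := 57 / 100)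
    (by linarith) (by linarith) (by linarith) (by linarith)
  have ua := taylor_le_negMulLog (x := 1 - α) (y := 1 - a) (m := 96 / 100) (by norm_num)
    (by linarith) (by linarith)
  have ub := taylor_le_negMulLog (x := 1 - β) (y := 1 - b) (m := 58 / 100) (by norm_num)
    (by linarith) (by linarith)
  have q := densityBox_quadratic (a - α) (b - β)
  unfold blockExponent
  rw [show b + (1 - a - b) = 1 - a by ring, show a + (1 - a - b) = 1 - b by ring,
    show β + (1 - α - β) = 1 - α by ring, show α + (1 - α - β) = 1 - β by ring,
    show a + b + (1 - a - b) = α + β + (1 - α - β) by ring]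
  rw [show 1 - a - b - (1 - α - β) = -(a - α + (b - β)) by ring, neg_sq] at tc
  rw [show 1 - a - (1 - α) = -(a - α) by ring, neg_sq] at ua
  rw [show 1 - b - (1 - β) = -(b - β) by ring, neg_sq] at ub
  linarith

/-- The tangent bound for blocks of total weight `T`. -/
theorem blockExponent_le_tangent_mul {α β p r : ℝ} (hpr : ∀ a b : ℝ,
    InDensityBox a b → blockExponent a b (1 - a - b) ≤ blockExponent α β (1 - α - β)
      + p * (a - α) + r * (b - β) - ((a - α) ^ 2 + (b - β) ^ 2) / 10)
    {a b c T : ℝ} (hT : 0 < T) (habc : a + b + c = T) (hbox : InDensityBox (a / T) (b / T)) :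
    blockExponent a b c ≤ T * blockExponent α β (1 - α - β) + p * (a - T * α) + r * (b - T * β)
      - T * (((a / T - α) ^ 2 + (b / T - β) ^ 2) / 10) := by
  have hc : c / T = 1 - a / T - b / T := by
    rw [show c = T - a - b by linarith, sub_div, sub_div, div_self hT.ne']
  have e : blockExponent a b c = T * blockExponent (a / T) (b / T) (1 - a / T - b / T) := by
    rw [← hc, ← blockExponent_mul, mul_div_cancel₀ _ hT.ne', mul_div_cancel₀ _ hT.ne',
      mul_div_cancel₀ _ hT.ne']
  rw [e]
  refine (mul_le_mul_of_nonneg_left (hpr _ _ hbox) hT.le).trans_eq ?_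
  field_simp

/-- Near the product point the exponent is smaller than at the product point. -/
theorem eq_product_of_le_of_box {α β γ δ ε k : ℝ} (hbox : InDensityBox α β)
    (h : (γ, δ, ε) ∈ admissibleRegion α β) (hk : k = freeEdges α β γ δ ε)
    (h1 : InDensityBox (γ / α) ((α - γ - ε) / α))
    (h2 : InDensityBox ((α - γ - k) / β) (δ / β))
    (h3 : InDensityBox (k / (1 - α - β)) ((β - δ - (α - γ - ε)) / (1 - α - β)))
    (hle : secondMomentExponent 6 1 α β (α ^ 2) (β ^ 2) (α * (1 - α - β)) ≤
      secondMomentExponent 6 1 α β γ δ ε) :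
    γ = α ^ 2 ∧ δ = β ^ 2 ∧ ε = α * (1 - α - β) := by
  obtain ⟨p, r, hpr⟩ := blockExponent_le_tangent hbox
  obtain ⟨a1, a2, b1, b2⟩ := hbox
  have hα : 0 < α := by linarith
  have hβ : 0 < β := by linarith
  have hc : 0 < 1 - α - β := by linarith
  have hT : 0 < 1 - β - γ - ε := by
    have := h.1.1
    simp only at this
    linarith
  have hle' := secondMomentExponent_le_blocks h hT hk
  rw [secondMomentExponent_product] at hle
  have u1 := blockExponent_le_tangent_mul hpr hα (show γ + (α - γ - ε) + ε = α by ring) h1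
  have u2 := blockExponent_le_tangent_mul hpr hβ
    (show α - γ - k + δ + (β - δ - (α - γ) + k) = β by ring) h2
  have u3 := blockExponent_le_tangent_mul hpr hc
    (show k + (β - δ - (α - γ - ε)) + (1 - 2 * β + δ - γ - ε - k) = 1 - α - β by ring) h3
  have n1 : 0 ≤ α * (((γ / α - α) ^ 2 + ((α - γ - ε) / α - β) ^ 2) / 10) := by positivity
  have n2 : 0 ≤ β * ((((α - γ - k) / β - α) ^ 2 + (δ / β - β) ^ 2) / 10) := by positivity
  have n3 : 0 ≤ (1 - α - β) * (((k / (1 - α - β) - α) ^ 2 +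
      ((β - δ - (α - γ - ε)) / (1 - α - β) - β) ^ 2) / 10) := by positivity
  -- Over the three blocks the left weights total α and the right weights total β, so the terms in p
  -- and r cancel and only the quadratic losses remain.
  have hsum : α * (((γ / α - α) ^ 2 + ((α - γ - ε) / α - β) ^ 2) / 10)
      + β * ((((α - γ - k) / β - α) ^ 2 + (δ / β - β) ^ 2) / 10)
      + (1 - α - β) * (((k / (1 - α - β) - α) ^ 2 +
        ((β - δ - (α - γ - ε)) / (1 - α - β) - β) ^ 2) / 10) ≤ 0 := by
    generalize α * (((γ / α - α) ^ 2 + ((α - γ - ε) / α - β) ^ 2) / 10) = N₁ at *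
    generalize β * ((((α - γ - k) / β - α) ^ 2 + (δ / β - β) ^ 2) / 10) = N₂ at *
    generalize (1 - α - β) * (((k / (1 - α - β) - α) ^ 2 +
      ((β - δ - (α - γ - ε)) / (1 - α - β) - β) ^ 2) / 10) = N₃ at *
    generalize blockExponent α β (1 - α - β) = Φ at *
    have := hle.trans (hle'.trans (add_le_add (add_le_add (add_le_add_right u1 _) u2) u3))
    linarith
  obtain ⟨z1, z2⟩ :=
    eq_zero_of_mul_sq_add_sq_nonpos (x := γ / α - α) (y := (α - γ - ε) / α - β) hα (by linarith)
  obtain ⟨-, z3⟩ :=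
    eq_zero_of_mul_sq_add_sq_nonpos (x := (α - γ - k) / β - α) (y := δ / β - β) hβ (by linarith)
  rw [sub_eq_zero, div_eq_iff hα.ne'] at z1 z2
  rw [sub_eq_zero, div_eq_iff hβ.ne'] at z3
  exact ⟨by rw [z1, sq], by rw [z3, sq], by linarith⟩

/-! ### The maximum for nearby densities -/

/-- In the entropy form no quotient occurs and `negMulLog` is continuous on all of ℝ, so the
boundary of the region needs no separate treatment. -/
theorem continuous_secondMomentExponent : Continuous fun z : (ℝ × ℝ) × (ℝ × ℝ × ℝ) =>
    secondMomentExponent 6 1 z.1.1 z.1.2 z.2.1 z.2.2.1 z.2.2.2 := by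
  simp only [secondMomentExponent_eq]
  fun_prop

theorem isClosed_admissible : IsClosed {z : (ℝ × ℝ) × (ℝ × ℝ × ℝ) |
    z.2 ∈ admissibleRegion z.1.1 z.1.2} := by
  have c : ∀ f : (ℝ × ℝ) × (ℝ × ℝ × ℝ) → ℝ, Continuous f → IsClosed {z | 0 ≤ f z} :=
    fun f hf => isClosed_le continuous_const hf
  exact ((c (fun z => z.1.1 - z.2.1 - z.2.2.2) (by fun_prop)).inter
    ((c (fun z => z.1.2 - z.2.2.1) (by fun_prop)).inter
      (c (fun z => 1 - 2 * z.1.2 + z.2.2.1 - z.2.1 - z.2.2.2) (by fun_prop)))).inter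
    (((c (fun z => z.2.1) (by fun_prop)).inter
      ((c (fun z => z.2.2.1) (by fun_prop)).inter (c (fun z => z.2.2.2) (by fun_prop)))).inter
    ((c (fun z => z.1.2 - z.2.2.1 - (z.1.1 - z.2.1 - z.2.2.2)) (by fun_prop)).inter
      (c (fun z => 1 - z.1.1 - z.1.2 - z.2.2.2) (by fun_prop))))

theorem isOpen_inDensityBox : IsOpen {y : ℝ × ℝ | InDensityBox y.1 y.2} := by
  exact (isOpen_lt continuous_const continuous_fst).inter
    ((isOpen_lt continuous_fst continuous_const).inter
      ((isOpen_lt continuous_const continuous_snd).inter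
        (isOpen_lt continuous_snd continuous_const)))

theorem eventually_inDensityBox {X : Type*} [TopologicalSpace X] {u v : X → ℝ} {x : X}
    (hu : ContinuousAt u x) (hv : ContinuousAt v x) (h : InDensityBox (u x) (v x)) :
    ∀ᶠ z in 𝓝 x, InDensityBox (u z) (v z) :=
  (hu.prodMk hv).eventually (isOpen_inDensityBox.mem_nhds h)

/-- At the product point the relative densities of all three blocks equal (α, β). By continuity they
stay in the open box when the densities and the triple vary together. -/
theorem eventually_lt_product_near {α β : ℝ} (hbox : InDensityBox α β) :
    ∀ᶠ z : (ℝ × ℝ) × (ℝ × ℝ × ℝ) in 𝓝 ((α, β), (α ^ 2, β ^ 2, α * (1 - α - β))),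
      z.2 ∈ admissibleRegion z.1.1 z.1.2 →
      z.2 ≠ (z.1.1 ^ 2, z.1.2 ^ 2, z.1.1 * (1 - z.1.1 - z.1.2)) →
      secondMomentExponent 6 1 z.1.1 z.1.2 z.2.1 z.2.2.1 z.2.2.2 <
        secondMomentExponent 6 1 z.1.1 z.1.2 (z.1.1 ^ 2) (z.1.2 ^ 2)
          (z.1.1 * (1 - z.1.1 - z.1.2)) := by
  obtain ⟨a1, a2, b1, b2⟩ := id hbox
  have hα : α ≠ 0 := by linarith
  have hβ : β ≠ 0 := by linarith
  have hc : 1 - α - β ≠ 0 := by linarith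
  have hα1 : 1 - α ≠ 0 := by linarith
  have hβ1 : 1 - β ≠ 0 := by linarith
  have hT : 1 - β - α ^ 2 - α * (1 - α - β) = (1 - α) * (1 - β) := by ring
  have hk : freeEdges α β (α ^ 2) (β ^ 2) (α * (1 - α - β)) = (1 - α - β) * α := by
    rw [freeEdges, hT, div_eq_iff (mul_ne_zero hα1 hβ1)]; ring
  have ck : ContinuousAt (fun z : (ℝ × ℝ) × (ℝ × ℝ × ℝ) =>
      freeEdges z.1.1 z.1.2 z.2.1 z.2.2.1 z.2.2.2)
      ((α, β), (α ^ 2, β ^ 2, α * (1 - α - β))) := by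
    unfold freeEdges
    refine ContinuousAt.div (by fun_prop) (by fun_prop) ?_
    simp only [hT]
    exact mul_ne_zero hα1 hβ1
  have e0 := eventually_inDensityBox (u := fun z : (ℝ × ℝ) × (ℝ × ℝ × ℝ) => z.1.1)
    (v := fun z => z.1.2) (x := ((α, β), (α ^ 2, β ^ 2, α * (1 - α - β))))
    (by fun_prop) (by fun_prop) hbox
  have e1 := eventually_inDensityBox (u := fun z : (ℝ × ℝ) × (ℝ × ℝ × ℝ) => z.2.1 / z.1.1)
    (v := fun z => (z.1.1 - z.2.1 - z.2.2.2) / z.1.1)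
    (x := ((α, β), (α ^ 2, β ^ 2, α * (1 - α - β))))
    (ContinuousAt.div (by fun_prop) (by fun_prop) hα)
    (ContinuousAt.div (by fun_prop) (by fun_prop) hα) (by
      convert hbox using 1
      · field_simp
      · rw [div_eq_iff hα]; ring)
  have e2 := eventually_inDensityBox (u := fun z : (ℝ × ℝ) × (ℝ × ℝ × ℝ) =>
      (z.1.1 - z.2.1 - freeEdges z.1.1 z.1.2 z.2.1 z.2.2.1 z.2.2.2) / z.1.2)
    (v := fun z => z.2.2.1 / z.1.2)
    (x := ((α, β), (α ^ 2, β ^ 2, α * (1 - α - β))))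
    (ContinuousAt.div (ContinuousAt.sub (by fun_prop) ck) (by fun_prop) hβ)
    (ContinuousAt.div (by fun_prop) (by fun_prop) hβ) (by
      convert hbox using 1
      · simp only [hk]; rw [div_eq_iff hβ]; ring
      · field_simp)
  have e3 := eventually_inDensityBox (u := fun z : (ℝ × ℝ) × (ℝ × ℝ × ℝ) =>
      freeEdges z.1.1 z.1.2 z.2.1 z.2.2.1 z.2.2.2 / (1 - z.1.1 - z.1.2))
    (v := fun z => (z.1.2 - z.2.2.1 - (z.1.1 - z.2.1 - z.2.2.2)) / (1 - z.1.1 - z.1.2))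
    (x := ((α, β), (α ^ 2, β ^ 2, α * (1 - α - β))))
    (ContinuousAt.div ck (by fun_prop) hc)
    (ContinuousAt.div (by fun_prop) (by fun_prop) hc) (by
      convert hbox using 1
      · simp only [hk]; rw [div_eq_iff hc]; ring
      · rw [div_eq_iff hc]; ring)
  filter_upwards [e0, e1, e2, e3] with z h0 h1 h2 h3 hz hne
  by_contra! hle
  obtain ⟨g1, g2, g3⟩ := eq_product_of_le_of_box h0 (γ := z.2.1) (δ := z.2.2.1) (ε := z.2.2.2)
    hz rfl h1 h2 h3 hle
  exact hne (Prod.ext g1 (Prod.ext g2 g3))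

theorem eventually_attainsUniqueMaxAt {α β : ℝ} (hbox : InDensityBox α β)
    (hmax : ∀ γ δ ε : ℝ, (γ, δ, ε) ∈ admissibleRegion α β →
      secondMomentExponent 6 1 α β (α ^ 2) (β ^ 2) (α * (1 - α - β)) ≤
        secondMomentExponent 6 1 α β γ δ ε →
      γ = α ^ 2 ∧ δ = β ^ 2 ∧ ε = α * (1 - α - β)) :
    ∀ᶠ y : ℝ × ℝ in 𝓝 (α, β), AttainsUniqueMaxAt
      (fun x : ℝ × ℝ × ℝ => secondMomentExponent 6 1 y.1 y.2 x.1 x.2.1 x.2.2)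
      (admissibleRegion y.1 y.2) (y.1 ^ 2, y.2 ^ 2, y.1 * (1 - y.1 - y.2)) := by
  have hK : IsCompact (Set.Icc (0 : ℝ) 1 ×ˢ Set.Icc (0 : ℝ) 1 ×ˢ Set.Icc (0 : ℝ) 1) :=
    isCompact_Icc.prod (isCompact_Icc.prod isCompact_Icc)
  have hprod : Continuous fun z : (ℝ × ℝ) × (ℝ × ℝ × ℝ) =>
      secondMomentExponent 6 1 z.1.1 z.1.2 (z.1.1 ^ 2) (z.1.2 ^ 2)
        (z.1.1 * (1 - z.1.1 - z.1.2)) := by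
    simp only [secondMomentExponent_eq]
    fun_prop
  -- Each point of the cube is of one of three kinds: the product point (local concavity), another
  -- admissible point (strict inequality is an open condition), or an inadmissible one
  -- (admissibility is closed).
  have key := hK.eventually_forall_of_forall_eventually (x₀ := (α, β))
    (P := fun y x => x ∈ admissibleRegion y.1 y.2 →
      x ≠ (y.1 ^ 2, y.2 ^ 2, y.1 * (1 - y.1 - y.2)) →
      secondMomentExponent 6 1 y.1 y.2 x.1 x.2.1 x.2.2 <
        secondMomentExponent 6 1 y.1 y.2 (y.1 ^ 2) (y.2 ^ 2) (y.1 * (1 - y.1 - y.2))) (by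
      intro x _
      by_cases hx : x ∈ admissibleRegion α β
      · by_cases hne : x = (α ^ 2, β ^ 2, α * (1 - α - β))
        · rw [hne]
          exact eventually_lt_product_near hbox
        · have hlt : secondMomentExponent 6 1 α β x.1 x.2.1 x.2.2 <
              secondMomentExponent 6 1 α β (α ^ 2) (β ^ 2) (α * (1 - α - β)) := by
            by_contra! hle
            obtain ⟨g1, g2, g3⟩ := hmax _ _ _ hx hle
            exact hne (Prod.ext g1 (Prod.ext g2 g3))
          filter_upwards [(isOpen_lt continuous_secondMomentExponent hprod).mem_nhds
            (show ((α, β), x) ∈ _ from hlt)] with z hz _ _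
          exact hz
      · filter_upwards [isClosed_admissible.isOpen_compl.mem_nhds
          (show ((α, β), x) ∈ _ from hx)] with z hz hz'
        exact absurd hz' hz)
  filter_upwards [key, isOpen_inDensityBox.mem_nhds hbox] with y hy hybox
  obtain ⟨a1, a2, b1, b2⟩ := hybox
  refine ⟨product_mem_admissibleRegion (by linarith) (by linarith) (by linarith),
    fun x hx hne => hy x ?_ hx hne⟩
  -- The unit cube contains the admissible regions of all densities in the box, so one compact set
  -- serves them all.
  obtain ⟨⟨h1, h2, h3⟩, ⟨h4, h5, h6⟩, h7, h8⟩ := hx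
  exact ⟨⟨h4, by linarith⟩, ⟨h5, by linarith⟩, ⟨h6, by linarith⟩⟩

theorem mainTheorem6 :
    ∃ pPlus pMinus : ℝ, AreExtremalDensities 6 1 pPlus pMinus ∧
      ∃ χ : ℝ, 0 < χ ∧ ∀ α β : ℝ, |pPlus - β| < χ → |pMinus - α| < χ →
        AttainsUniqueMaxAt
          (fun x : ℝ × ℝ × ℝ => secondMomentExponent 6 1 α β x.1 x.2.1 x.2.2)
          (admissibleRegion α β)
          (α ^ 2, β ^ 2, α * (1 - α - β)) := by
  obtain ⟨s, t, hs, hs', hst, hts, hdens⟩ := exists_areExtremalDensities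
  have hev := eventually_attainsUniqueMaxAt (density_bounds hs hs' hst)
    (fun γ δ ε h hle => eq_product_of_le hs hs' hst hts rfl rfl h hle)
  obtain ⟨χ, hχ, h⟩ := Metric.eventually_nhds_iff.1 hev
  refine ⟨_, _, hdens, χ, hχ, fun α β hβ hα => h (y := (α, β)) ?_⟩
  rw [Prod.dist_eq, max_lt_iff, dist_comm, Real.dist_eq, dist_comm, Real.dist_eq]
  exact ⟨hα, hβ⟩
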